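/- Let $K$ be a field that is complete with respect to a (nontrivial) discrete non-archimedean valuation $v:K\to\mathbb{R}\cup\{\infty\}$, with valuation ring $A$, maximal ideal $\mathfrak{M}=\pi A$ and residue field $k=A/\mathfrak{M}$. Fix a set $\Delta\subseteq A\setminus\mathfrak{M}$ of representatives of $k^*$; every $x\in K^*$ is uniquely $x=\pi^{n}\,d\,e$ with $n=v(x)/v(\pi)\in\mathbb{Z}$, $d\in\Delta$ (whose class in $k^*$ is the first digit of $x$) and $e\in 1+\mathfrak{M}$ (the tail of $x$). Let $D_1$ and $D_2$ be probability distributions on $k^*$ and on $1+\mathfrak{M}$, and let $M>0$. Choose a random element of $K^*$ by choosing, independently, its valuation uniformly in the finite set $[-M,M]\cap v(\pi)\mathbb{Z}$, its first digit according to $D_1$ and its tail according to $D_2$. For a finite set $\mathcal{A}\subset\mathbb{Z}$ with $t=|\mathcal{A}|\ge 2$, let $E(\mathcal{A},D_1,D_2,M,K)$ be the expected number of distinct roots in $K^*$ of the random Laurent polynomial $f=\sum_{\alpha\in\mathcal{A}}a_\alpha X^\alpha$, whose coefficients $a_\alpha\in K^*$ are chosen independently in this way. Suppose that $k$ is algebraically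 closed with $\operatorname{char}(k)=0$ or $\operatorname{char}(k)>\max_{\alpha,\beta\in\mathcal{A}}|\alpha-\beta|$. Then the limit $$E(\mathcal{A},K)=\lim_{M\to\infty}E(\mathcal{A},D_1,D_2,M,K)$$ exists, does not depend on $D_1$ and $D_2$ (nor on the choice of $\pi$ and $\Delta$), and satisfies $$2-\frac{2}{t}\le E(\mathcal{A},K)\le 2\ln t.$$ -/

import Mathlib

open MeasureTheory ProbabilityTheory Filter Topology
open scoped Valued NormedField ENNReal

noncomputable section

namespace RandomRoots

/- A field `K` with a complete discrete non-archimedean real valuation `v` is a complete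
ultrametric normed field (with `‖x‖ = exp (-v x)`) whose ring of integers `𝒪[K] = A` is a discrete
valuation ring; `𝓂[K]` is the maximal ideal and `𝓀[K] = k` the residue field. -/
variable (K : Type*) [NormedField K] [IsUltrametricDist K]

/-- The additive real valuation `v x = -log ‖x‖` (used for nonzero `x` only). -/
def val (x : K) : ℝ := -Real.log ‖x‖

/-- The set `1 + 𝓂` of possible tails. -/
def OneUnits : Set 𝒪[K] := {x | x - 1 ∈ 𝓂[K]}

/-- `Δ` chooses, for every first digit, a representative in `A \ 𝓂`. -/
def IsDigitSection (Δ : 𝓀[K]ˣ → 𝒪[K]) : Prop :=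
  ∀ ε : 𝓀[K]ˣ, IsLocalRing.residue 𝒪[K] (Δ ε) = ε

/-- The data determining a nonzero element of `K`: its valuation (as an integer multiple of the
valuation of the uniformizer), its first digit and its tail. -/
abbrev CoeffData : Type _ := ℤ × 𝓀[K]ˣ × OneUnits K

variable {K}

/-- The nonzero element `π ^ n * Δ(δ) * e` of `K` with valuation `n * v π`, first digit `δ` and
tail `e`. -/
def coeff (ϖ : 𝒪[K]) (Δ : 𝓀[K]ˣ → 𝒪[K]) (c : CoeffData K) : K :=
  (ϖ : K) ^ c.1 * (Δ c.2.1 : K) * ((c.2.2 : 𝒪[K]) : K)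

/-- The Laurent polynomial `∑ a_α X ^ α`, `α ∈ 𝒜`. -/
def poly (𝒜 : Finset ℤ) (a : 𝒜 → K) : LaurentPolynomial K :=
  ∑ α : 𝒜, LaurentPolynomial.C (a α) * LaurentPolynomial.T (α : ℤ)

/-- The set of (distinct) roots in `K* ` of a Laurent polynomial. -/
def zeroSet (f : LaurentPolynomial K) : Set Kˣ :=
  {x | LaurentPolynomial.eval₂ (RingHom.id K) x f = 0}

/-- The valuation of a coefficient is uniform in `[-M, M] ∩ v(π)ℤ`; it is recorded by the
integer `n` with valuation `n * v π`. -/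
def valuationLaw (ϖ : 𝒪[K]) (M : ℝ) : Measure ℤ :=
  uniformOn {n : ℤ | (n : ℝ) * val K (ϖ : K) ∈ Set.Icc (-M) M}

/-- The law of one coefficient: valuation, first digit and tail are independent, with the uniform
law on `[-M, M] ∩ v(π)ℤ`, the law `D₁` and the law `D₂`. -/
def coeffLaw (ϖ : 𝒪[K]) [MeasurableSpace 𝓀[K]ˣ] (D₁ : Measure 𝓀[K]ˣ)
    [MeasurableSpace (OneUnits K)] (D₂ : Measure (OneUnits K)) (M : ℝ) :
    Measure (CoeffData K) :=
  (valuationLaw ϖ M).prod (D₁.prod D₂)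

/-- The expected number of roots in `K*` of a polynomial with support `𝒜` and independent
coefficients of law `coeffLaw`. For every choice of σ-algebras for which the number of roots is a
measurable function, this is its expectation; it makes sense (as a lower integral) for all. -/
def expectedRoots (𝒜 : Finset ℤ) (ϖ : 𝒪[K]) (Δ : 𝓀[K]ˣ → 𝒪[K])
    [MeasurableSpace 𝓀[K]ˣ] (D₁ : Measure 𝓀[K]ˣ)
    [MeasurableSpace (OneUnits K)] (D₂ : Measure (OneUnits K)) (M : ℝ) : ℝ≥0∞ :=
  ∫⁻ c : 𝒜 → CoeffData K, ((zeroSet (poly 𝒜 fun α => coeff ϖ Δ (c α))).encard : ℝ≥0∞)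
    ∂(Measure.pi fun _ => coeffLaw ϖ D₁ D₂ M)

end RandomRoots

end

/-! The proof is a Newton polygon argument followed by a count of lattice points. Let `n γ` be the
integer valuations of the coefficients. A root of valuation `m` forces the minimum of `n γ + m * γ`
to be attained twice. If it is attained exactly at `α < β`, then after rescaling the polynomial
reduces over the residue field to a binomial with `d = β - α` nonzero roots. The hypothesis on the
characteristic makes them simple, and Hensel's lemma lifts each of them uniquely
(`encard_rootsOfValuation`). Hence, unless three of the points `(γ, n γ)` are collinear, the number
of roots is `edgeLength n`, the total length of the lower edges of integral slope. Digits and tails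
play no part.

Integrality of the slope over `(α, β)` is the congruence `n α ≡ n β` modulo `d`, which cuts the
density of integer points in a convex cone by the factor `d` (`tendsto_card_cone`). This factor
cancels the length `d` of the edge. The limit is therefore the expected number of lower edges over
independent heights uniform in `[-1, 1]`. Collinear configurations have density zero, and there the
degree bounds the number of roots.

Lower edges are ascending or descending, and a reflection exchanges the two kinds. At most one
ascending edge starts at a given point, and only if that point is strictly lowest among the points
from it on to the right. With `r` such points this has probability at most `1/r`, and summing over
`2 ≤ r ≤ t` gives at most `log t` (`ascendingMass_le`). Conversely, an ascending edge starts at the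
overall minimum unless that is the last point, which gives at least `1 - 1/t` (`le_ascendingMass`).
Doubling yields both bounds. -/

namespace RandomRoots

/-! ### Expected number of lower edges over random heights. -/

section Geometry

variable {ι : Type*}

/-- The height vectors `x` for which all points `(p k, x k)`, `k ≠ i, j`, lie strictly above the
line through `(p i, x i)` and `(p j, x j)` (when `p i < p j`). -/
def edgeSet (p : ι → ℝ) (i j : ι) : Set (ι → ℝ) :=
  {x | ∀ k, k ≠ i → k ≠ j → x i * (p j - p k) + x j * (p k - p i) < x k * (p j - p i)}

/-- The height vectors for which the points with indices `i`, `j`, `k` are collinear. -/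
def collinearSet (p : ι → ℝ) (i j k : ι) : Set (ι → ℝ) :=
  {x | x i * (p j - p k) + x j * (p k - p i) = x k * (p j - p i)}

/-- Reflecting the positions turns descending edges into ascending ones, so only ascending edges
need estimates. -/
theorem edgeSet_neg (p : ι → ℝ) (i j : ι) : edgeSet (-p) i j = edgeSet p j i := by
  ext x
  simp only [edgeSet, Set.mem_ofPred_eq, Pi.neg_apply]
  constructor
  · intro h k hj hi
    linarith [h k hi hj]
  · intro h k hi hj
    linarith [h k hj hi]

/-- Convexity makes the frontier a null set, which the lattice point count requires. -/
theorem convex_edgeSet (p : ι → ℝ) (i j : ι) : Convex ℝ (edgeSet p i j) := by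
  intro x hx y hy a b ha hb hab k hi hj
  have h1 := hx k hi hj
  have h2 := hy k hi hj
  simp only [Pi.add_apply, Pi.smul_apply, smul_eq_mul]
  rcases ha.eq_or_lt with rfl | ha
  · have : b = 1 := by linarith
    subst this; simpa using h2
  · nlinarith [mul_lt_mul_of_pos_left h1 ha, mul_le_mul_of_nonneg_left h2.le hb]

theorem convex_collinearSet (p : ι → ℝ) (i j k : ι) : Convex ℝ (collinearSet p i j k) := by
  intro x hx y hy a b ha hb hab
  simp only [collinearSet, Set.mem_ofPred_eq] at hx hy
  simp only [collinearSet, Set.mem_ofPred_eq, Pi.add_apply, Pi.smul_apply, smul_eq_mul]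
  linear_combination a * hx + b * hy

theorem smul_mem_edgeSet_iff (p : ι → ℝ) (i j : ι) {c : ℝ} (hc : 0 < c) (x : ι → ℝ) :
    c • x ∈ edgeSet p i j ↔ x ∈ edgeSet p i j := by
  simp only [edgeSet, Set.mem_ofPred_eq, Pi.smul_apply, smul_eq_mul]
  refine forall_congr' fun k => forall_congr' fun _ => forall_congr' fun _ => ?_
  rw [← mul_lt_mul_iff_right₀ hc (b := x i * (p j - p k) + x j * (p k - p i))]
  ring_nf

theorem smul_mem_collinearSet_iff (p : ι → ℝ) (i j k : ι) {c : ℝ} (hc : 0 < c) (x : ι → ℝ) :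
    c • x ∈ collinearSet p i j k ↔ x ∈ collinearSet p i j k := by
  simp only [collinearSet, Set.mem_ofPred_eq, Pi.smul_apply, smul_eq_mul]
  rw [← mul_right_inj' hc.ne' (b := x i * (p j - p k) + x j * (p k - p i))]
  ring_nf

theorem measurableSet_edgeSet [Fintype ι] (p : ι → ℝ) (i j : ι) : MeasurableSet (edgeSet p i j) := by
  have : edgeSet p i j = ⋂ k, ⋂ (_ : k ≠ i), ⋂ (_ : k ≠ j),
      {x | x i * (p j - p k) + x j * (p k - p i) < x k * (p j - p i)} := by
    ext x; simp [edgeSet]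
  rw [this]
  refine MeasurableSet.iInter fun k => MeasurableSet.iInter fun _ => MeasurableSet.iInter fun _ =>
    measurableSet_lt (by fun_prop) (by fun_prop)

theorem measurableSet_collinearSet (p : ι → ℝ) (i j k : ι) :
    MeasurableSet (collinearSet p i j k) :=
  measurableSet_eq_fun (by fun_prop) (by fun_prop)

variable [Fintype ι]

theorem volume_ker_eq_zero (L : (ι → ℝ) →ₗ[ℝ] ℝ) (hL : L ≠ 0) :
    volume {x : ι → ℝ | L x = 0} = 0 := by
  have h : {x : ι → ℝ | L x = 0} = (LinearMap.ker L : Set (ι → ℝ)) := by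
    ext x; simp
  rw [h]
  exact Measure.addHaar_submodule _ _ (fun h => hL (LinearMap.ker_eq_top.mp h))

theorem volume_collinearSet {p : ι → ℝ} {i j k : ι} (hij : p i ≠ p j) (hi : k ≠ i)
    (hj : k ≠ j) : volume (collinearSet p i j k) = 0 := by
  classical
  let L : (ι → ℝ) →ₗ[ℝ] ℝ := (p j - p k) • LinearMap.proj i + (p k - p i) • LinearMap.proj j
    - (p j - p i) • LinearMap.proj k
  have hL : L ≠ 0 := by
    intro h
    have h1 : L (Pi.single k 1) = 0 := by rw [h]; rfl
    simp [L, hi.symm, hj.symm, sub_eq_zero] at h1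
    exact hij h1
  rw [← volume_ker_eq_zero L hL]
  congr 1
  ext x
  simp only [collinearSet, Set.mem_ofPred_eq, L, LinearMap.sub_apply, LinearMap.add_apply,
    LinearMap.smul_apply, LinearMap.proj_apply, smul_eq_mul]
  constructor <;> intro h <;> linarith

theorem volume_eval_eq_eval {i j : ι} (hij : i ≠ j) : volume {x : ι → ℝ | x i = x j} = 0 := by
  classical
  let L : (ι → ℝ) →ₗ[ℝ] ℝ := LinearMap.proj (R := ℝ) (φ := fun _ => ℝ) i - LinearMap.proj j
  have hL : L ≠ 0 := by
    intro h
    have h1 : L (Pi.single i 1) = 0 := by rw [h]; rfl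
    simp [L, hij.symm] at h1
  rw [← volume_ker_eq_zero L hL]
  congr 1
  ext x
  simp [L, sub_eq_zero]

variable (ι) in
/-- Lebesgue measure on the cube `[-1, 1] ^ ι`. -/
noncomputable def cubeMeasure : Measure (ι → ℝ) := volume.restrict (Set.Icc (-1) 1)

theorem volume_cube : volume (Set.Icc (-1 : ι → ℝ) 1) = 2 ^ Fintype.card ι := by
  rw [Real.volume_Icc_pi]
  simp only [Pi.one_apply, Pi.neg_apply, Finset.prod_const, Finset.card_univ]
  norm_num

instance : IsFiniteMeasure (cubeMeasure ι) := by
  constructor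
  rw [cubeMeasure, Measure.restrict_apply_univ, volume_cube]
  finiteness

theorem cubeMeasure_real_univ : (cubeMeasure ι).real Set.univ = 2 ^ Fintype.card ι := by
  rw [measureReal_def, cubeMeasure, Measure.restrict_apply_univ, volume_cube]
  simp

theorem cubeMeasure_eq_zero {s : Set (ι → ℝ)} (h : volume s = 0) : cubeMeasure ι s = 0 :=
  le_antisymm ((Measure.restrict_apply_le _ _).trans h.le) bot_le

theorem cubeMeasure_real_comp_perm (σ : Equiv.Perm ι) {s : Set (ι → ℝ)} (hs : MeasurableSet s) :
    (cubeMeasure ι).real {x | (fun i => x (σ i)) ∈ s} = (cubeMeasure ι).real s := by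
  have hmp : MeasurePreserving (fun (x : ι → ℝ) i => x (σ i)) volume volume := by
    have := volume_measurePreserving_piCongrLeft (fun _ : ι => ℝ) σ.symm
    convert this using 1
    ext x i
    simp [MeasurableEquiv.piCongrLeft, Equiv.piCongrLeft, Equiv.piCongrLeft']
  have h2 := hmp.restrict_preimage (s := Set.Icc (-1) 1) measurableSet_Icc
  have h3 : (fun (x : ι → ℝ) i => x (σ i)) ⁻¹' Set.Icc (-1) 1 = Set.Icc (-1) 1 := by
    ext x
    simp only [Set.mem_preimage, Set.mem_Icc, Pi.le_def, Pi.neg_apply, Pi.one_apply]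
    rw [σ.forall_congr_right (q := fun i => -1 ≤ x i), σ.forall_congr_right (q := fun i => x i ≤ 1)]
  rw [h3] at h2
  exact h2.measureReal_preimage hs.nullMeasurableSet

/-- The height vectors whose coordinate `i` is the strict minimum over `B`. -/
def minSet (B : Finset ι) (i : ι) : Set (ι → ℝ) := {x | ∀ k ∈ B, k ≠ i → x i < x k}

theorem measurableSet_minSet (B : Finset ι) (i : ι) : MeasurableSet (minSet B i) := by
  have : minSet B i = ⋂ k, ⋂ (_ : k ∈ B), ⋂ (_ : k ≠ i), {x | x i < x k} := by
    ext x; simp [minSet]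
  rw [this]
  refine MeasurableSet.iInter fun k => MeasurableSet.iInter fun _ => MeasurableSet.iInter fun _ =>
    measurableSet_lt (by fun_prop) (by fun_prop)

/-- The sets `minSet B j`, `j ∈ B`, are disjoint and have equal mass, because the cube is invariant
under transpositions of coordinates. -/
theorem cubeMeasure_minSet_le (B : Finset ι) {i : ι} (hi : i ∈ B) :
    (cubeMeasure ι).real (minSet B i) ≤ 2 ^ Fintype.card ι / (B.card : ℝ) := by
  classical
  have heq : ∀ j ∈ B, (cubeMeasure ι).real (minSet B j) = (cubeMeasure ι).real (minSet B i) := by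
    intro j hj
    rw [← cubeMeasure_real_comp_perm (Equiv.swap i j) (measurableSet_minSet B i)]
    congr 1
    ext x
    simp only [minSet, Set.mem_ofPred_eq, Equiv.swap_apply_left]
    constructor
    · intro h k hk hki
      rcases eq_or_ne k j with rfl | hkj
      · rw [Equiv.swap_apply_right]
        exact h i hi hki.symm
      · rw [Equiv.swap_apply_of_ne_of_ne hki hkj]
        exact h k hk hkj
    · intro h k hk hkj
      rcases eq_or_ne k i with rfl | hki
      · simpa using h j hj hkj.symm
      · simpa [Equiv.swap_apply_of_ne_of_ne hki hkj] using h k hk hki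
  have hdisj : (B : Set ι).PairwiseDisjoint (minSet B) := by
    intro j hj k hk hjk
    refine Set.disjoint_left.mpr fun x hxj hxk => ?_
    exact lt_asymm (hxj k hk hjk.symm) (hxk j hj hjk)
  have h1 : ∑ j ∈ B, (cubeMeasure ι).real (minSet B j) ≤ 2 ^ Fintype.card ι := by
    rw [← measureReal_biUnion_finset hdisj fun j _ => measurableSet_minSet B j,
      ← cubeMeasure_real_univ]
    exact measureReal_mono (Set.subset_univ _)
  rw [Finset.sum_congr rfl heq, Finset.sum_const, nsmul_eq_mul] at h1
  rw [le_div_iff₀ (by exact_mod_cast Finset.card_pos.mpr ⟨i, hi⟩)]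
  linarith

/-- The mass of the ascending lower edges: the expected number of such edges times `2 ^ |ι|`. -/
noncomputable def ascendingMass (p : ι → ℝ) : ℝ :=
  ∑ i, ∑ j with p i < p j, (cubeMeasure ι).real (edgeSet p i j ∩ {x | x i < x j})

theorem measurableSet_ascending (p : ι → ℝ) (i j : ι) :
    MeasurableSet (edgeSet p i j ∩ {x | x i < x j}) :=
  (measurableSet_edgeSet p i j).inter (measurableSet_lt (by fun_prop) (by fun_prop))

theorem sum_edgeSet_eq (p : ι → ℝ) :
    ∑ i, ∑ j with p i < p j, (cubeMeasure ι).real (edgeSet p i j)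
      = ascendingMass p + ascendingMass (-p) := by
  have h2 : ascendingMass (-p) =
      ∑ i, ∑ j with p i < p j, (cubeMeasure ι).real (edgeSet p i j ∩ {x | x j < x i}) := by
    unfold ascendingMass
    simp only [edgeSet_neg, Pi.neg_apply, neg_lt_neg_iff, Finset.sum_filter]
    rw [Finset.sum_comm]
  rw [h2, ascendingMass, ← Finset.sum_add_distrib]
  refine Finset.sum_congr rfl fun i _ => ?_
  rw [← Finset.sum_add_distrib]
  refine Finset.sum_congr rfl fun j hj => ?_
  have hij : i ≠ j := by
    rintro rfl; simp at hj
  have hd : Disjoint (edgeSet p i j ∩ {x | x i < x j}) (edgeSet p i j ∩ {x | x j < x i}) :=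
    Set.disjoint_left.mpr <| by
    rintro x ⟨_, h1⟩ ⟨_, h2⟩
    exact lt_asymm (a := x i) (b := x j) h1 h2
  rw [← measureReal_union hd ((measurableSet_edgeSet p i j).inter
    (measurableSet_lt (by fun_prop) (by fun_prop)))]
  refine measureReal_congr ?_
  have hn : ∀ᵐ x ∂(cubeMeasure ι), ¬ x i = x j := by
    rw [ae_iff]
    simpa using cubeMeasure_eq_zero (volume_eval_eq_eval hij)
  filter_upwards [hn] with x hx
  refine propext ⟨fun h => ?_, fun h => ?_⟩
  · rcases lt_or_gt_of_ne hx with h1 | h1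
    · exact Or.inl ⟨h, h1⟩
    · exact Or.inr ⟨h, h1⟩
  · rcases h with h | h <;> exact h.1

/-- To the right of `i`, all points lie on or above an ascending line through `(p i, x i)`, so `x i`
is the strict minimum there. Two edges cannot both start at `i`: each endpoint would lie strictly
above the line of the other. -/
theorem sum_ascending_le {p : ι → ℝ} (hp : Function.Injective p) (i : ι) :
    ∑ j with p i < p j, (cubeMeasure ι).real (edgeSet p i j ∩ {x | x i < x j})
      ≤ (cubeMeasure ι).real (minSet {k | p i ≤ p k} i) := by
  rw [← measureReal_biUnion_finset _ fun j _ => measurableSet_ascending p i j]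
  · refine measureReal_mono ?_
    intro x hx
    simp only [Set.mem_iUnion] at hx
    obtain ⟨j, hj, hx1, hx2⟩ := hx
    replace hj : p i < p j := by simpa using hj
    replace hx2 : x i < x j := hx2
    intro k hk hki
    replace hk : p i < p k := lt_of_le_of_ne (by simpa using hk) fun h => hki (hp h).symm
    rcases eq_or_ne k j with rfl | hkj
    · exact hx2
    · have h1 := hx1 k hki hkj
      have h2 := mul_lt_mul_of_pos_right hx2 (sub_pos.mpr hk)
      refine lt_of_mul_lt_mul_right (a := p j - p i) ?_ (sub_pos.mpr hj).le
      linarith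
  · intro j hj k hk hjk
    replace hj : p i < p j := by simpa using hj
    replace hk : p i < p k := by simpa using hk
    refine Set.disjoint_left.mpr ?_
    rintro x ⟨h1, _⟩ ⟨h2, _⟩
    have h3 := h1 k (fun h => by simp [h] at hk) hjk.symm
    have h4 := h2 j (fun h => by simp [h] at hj) hjk
    linarith

theorem ascendingMass_le {p : ι → ℝ} (hp : Function.Injective p) :
    ascendingMass p ≤ 2 ^ Fintype.card ι * Real.log (Fintype.card ι) := by
  classical
  -- The rank counted from the right. The last point has rank `1` and starts no edge, so the
  -- harmonic sum begins at `2` and the bound `1 + log t` loses its `1`.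
  let r : ι → ℕ := fun i => (Finset.univ.filter fun k => p i ≤ p k).card
  have hr_lt : ∀ i j, p i < p j → r j < r i := by
    intro i j hij
    refine Finset.card_lt_card (Finset.ssubset_iff.mpr ⟨i, by simpa using hij, ?_⟩)
    intro k hk
    rcases Finset.mem_insert.mp hk with rfl | hk
    · simp
    · simp only [Finset.mem_filter, Finset.mem_univ, true_and] at hk ⊢
      exact hij.le.trans hk
  have hr_inj : Function.Injective r := by
    intro i j hij
    rcases lt_trichotomy (p i) (p j) with h | h | h
    · exact absurd hij (hr_lt i j h).ne'
    · exact hp h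
    · exact absurd hij (hr_lt j i h).ne
  have hr_pos : ∀ i, 1 ≤ r i := fun i => Finset.card_pos.mpr ⟨i, by simp⟩
  have hle : ∀ i, ∑ j with p i < p j, (cubeMeasure ι).real (edgeSet p i j ∩ {x | x i < x j})
      ≤ if 2 ≤ r i then 2 ^ Fintype.card ι * ((r i : ℝ))⁻¹ else 0 := by
    intro i
    split_ifs with h
    · refine (sum_ascending_le hp i).trans ?_
      rw [← div_eq_mul_inv]
      exact cubeMeasure_minSet_le _ (by simp)
    · refine (Finset.sum_eq_zero fun j hj => ?_).le
      have h1 := hr_lt i j (by simpa using hj)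
      have h2 := hr_pos j
      omega
  have hsum : ∑ n ∈ (Finset.univ.filter fun i => 2 ≤ r i).image r, ((n : ℝ))⁻¹
      ≤ ∑ n ∈ Finset.Icc 2 (Fintype.card ι), ((n : ℝ))⁻¹ := by
    refine Finset.sum_le_sum_of_subset_of_nonneg ?_ fun _ _ _ => by positivity
    intro n hn
    obtain ⟨i, hi, rfl⟩ := Finset.mem_image.mp hn
    exact Finset.mem_Icc.mpr ⟨by simpa using hi, Finset.card_le_univ _⟩
  have hharm : ∑ n ∈ Finset.Icc 2 (Fintype.card ι), ((n : ℝ))⁻¹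
      ≤ Real.log (Fintype.card ι) := by
    rcases Nat.eq_zero_or_pos (Fintype.card ι) with h0 | h0
    · simp [h0]
    · have h1 := harmonic_le_one_add_log (Fintype.card ι)
      rw [harmonic_eq_sum_Icc, Rat.cast_sum, ← Finset.insert_Icc_add_one_left_eq_Icc h0,
        Finset.sum_insert (by simp)] at h1
      simp only [Nat.cast_one, Rat.cast_inv, Rat.cast_one, Rat.cast_natCast, inv_one] at h1
      exact le_of_add_le_add_left h1
  calc ascendingMass p ≤ ∑ i, if 2 ≤ r i then 2 ^ Fintype.card ι * ((r i : ℝ))⁻¹ else 0 :=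
        Finset.sum_le_sum fun i _ => hle i
    _ = 2 ^ Fintype.card ι * ∑ n ∈ (Finset.univ.filter fun i => 2 ≤ r i).image r, ((n : ℝ))⁻¹ := by
        rw [Finset.sum_image hr_inj.injOn, ← Finset.sum_filter, Finset.mul_sum]
    _ ≤ _ := mul_le_mul_of_nonneg_left (hsum.trans hharm) (by positivity)

theorem ae_generic {p : ι → ℝ} (hp : Function.Injective p) :
    ∀ᵐ x ∂(cubeMeasure ι), (∀ i j, i ≠ j → x i ≠ x j) ∧
      ∀ i j k, i ≠ j → k ≠ i → k ≠ j → x ∉ collinearSet p i j k := by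
  refine Filter.Eventually.and ?_ ?_
  · refine ae_all_iff.mpr fun i => ae_all_iff.mpr fun j => ?_
    by_cases h : i = j
    · simp [h]
    · have : ∀ᵐ x ∂(cubeMeasure ι), x i ≠ x j := by
        rw [ae_iff]
        simpa using cubeMeasure_eq_zero (volume_eval_eq_eval h)
      filter_upwards [this] with x hx _ using hx
  · refine ae_all_iff.mpr fun i => ae_all_iff.mpr fun j => ae_all_iff.mpr fun k => ?_
    by_cases h : i ≠ j ∧ k ≠ i ∧ k ≠ j
    · have : ∀ᵐ x ∂(cubeMeasure ι), x ∉ collinearSet p i j k :=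
        measure_eq_zero_iff_ae_notMem.mp
          (cubeMeasure_eq_zero (volume_collinearSet (hp.ne h.1) h.2.1 h.2.2))
      filter_upwards [this] with x hx _ _ _ using hx
    · exact Filter.Eventually.of_forall fun x h1 h2 h3 => absurd ⟨h1, h2, h3⟩ h

/-- From a strict minimum which is not the last point, an ascending lower edge starts. -/
theorem exists_ascending_of_isMin {p : ι → ℝ} {x : ι → ℝ}
    (hp : Function.Injective p) (h₁ : ∀ i j, i ≠ j → x i ≠ x j)
    (h₂ : ∀ i j k, i ≠ j → k ≠ i → k ≠ j → x ∉ collinearSet p i j k) {i l : ι}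
    (hi : ∀ k, x i ≤ x k) (hl : p i < p l) :
    ∃ j, p i < p j ∧ x ∈ edgeSet p i j ∧ x i < x j := by
  classical
  -- The edge goes to the point of smallest slope seen from `i`. Points to the left of `i` are above
  -- its line, since the line ascends and `x i` is the minimum.
  obtain ⟨j, hj, hmin⟩ := Finset.exists_min_image (Finset.univ.filter fun k => p i < p k)
    (fun k => (x k - x i) / (p k - p i)) ⟨l, by simpa using hl⟩
  replace hj : p i < p j := by simpa using hj
  have hij : i ≠ j := fun h => by simp [h] at hj
  have hxij : x i < x j := lt_of_le_of_ne (hi j) (h₁ i j hij)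
  refine ⟨j, hj, fun k hki hkj => ?_, hxij⟩
  have hne : x i * (p j - p k) + x j * (p k - p i) ≠ x k * (p j - p i) := h₂ i j k hij hki hkj
  refine lt_of_le_of_ne ?_ hne
  rcases lt_or_gt_of_ne (hp.ne hki) with h | h
  · have h3 := mul_le_mul_of_nonneg_right (hi k) (sub_pos.mpr hj).le
    have h4 := mul_le_mul_of_nonneg_right hxij.le (sub_pos.mpr h).le
    linarith
  · have h3 := hmin k (by simpa using h)
    rw [div_le_div_iff₀ (sub_pos.mpr hj) (sub_pos.mpr h)] at h3
    linarith

theorem le_ascendingMass {p : ι → ℝ} (hp : Function.Injective p) [Nonempty ι] :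
    2 ^ Fintype.card ι * (1 - 1 / (Fintype.card ι : ℝ)) ≤ ascendingMass p := by
  obtain ⟨l, hl⟩ := Finite.exists_max p
  -- The index `l` is the rightmost position. Almost surely the minimum is at `l` or an ascending
  -- edge starts at it.
  have hsub : ∀ᵐ x ∂(cubeMeasure ι), x ∈ (⋃ i ∈ Finset.univ, ⋃ j ∈ Finset.univ.filter
      (fun j => p i < p j), edgeSet p i j ∩ {x | x i < x j}) ∪ minSet Finset.univ l := by
    filter_upwards [ae_generic hp] with x hx
    obtain ⟨i, hi⟩ := Finite.exists_min x
    rcases eq_or_ne i l with rfl | hil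
    · exact Or.inr fun k _ hk => lt_of_le_of_ne (hi k) (hx.1 i k hk.symm)
    · obtain ⟨j, hj1, hj2⟩ := exists_ascending_of_isMin hp hx.1 hx.2 hi
        (lt_of_le_of_ne (hl i) (hp.ne hil))
      refine Or.inl ?_
      simp only [Set.mem_iUnion]
      exact ⟨i, Finset.mem_univ _, j, by simpa using hj1, hj2⟩
  have h1 : (2 : ℝ) ^ Fintype.card ι ≤ ascendingMass p
      + 2 ^ Fintype.card ι / (Fintype.card ι : ℝ) := by
    rw [← cubeMeasure_real_univ, ← measureReal_congr (eventuallyEq_univ.mpr hsub)]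
    refine (measureReal_union_le _ _).trans (add_le_add ?_ ?_)
    · refine (measureReal_biUnion_finset_le _ _).trans (Finset.sum_le_sum fun i _ => ?_)
      exact measureReal_biUnion_finset_le _ _
    · rw [measureReal_congr (eventuallyEq_univ.mpr hsub), cubeMeasure_real_univ]
      exact cubeMeasure_minSet_le _ (Finset.mem_univ l)
  rw [mul_sub, mul_one, mul_one_div]
  linarith

end Geometry

/-! ### Integer points in convex cones, with a congruence. -/

section LatticeCounting

variable {ι : Type*} [Fintype ι]

/-- Integer points scaled by `n⁻¹`. -/
noncomputable def scale (n : ℕ) (m : ι → ℤ) : ι → ℝ := fun k => (n : ℝ)⁻¹ * m k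

omit [Fintype ι] in
theorem scale_injective {n : ℕ} (hn : n ≠ 0) :
    Function.Injective (scale n : (ι → ℤ) → ι → ℝ) := by
  intro a b hab
  ext k
  have h := congrFun hab k
  have hn' : (n : ℝ)⁻¹ ≠ 0 := by positivity
  exact_mod_cast mul_left_cancel₀ hn' h

open scoped Pointwise in
theorem card_scale_preimage {n : ℕ} (hn : n ≠ 0) (s : Set (ι → ℝ)) :
    Nat.card ↑(s ∩ (n : ℝ)⁻¹ • (Submodule.span ℤ (Set.range (Pi.basisFun ℝ ι)) : Set (ι → ℝ)))
      = Nat.card (scale n ⁻¹' s) := by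
  rw [← Nat.card_image_of_injective (scale_injective hn)]
  congr 2
  ext x
  have : NeZero n := ⟨hn⟩
  have key : x ∈ (n : ℝ)⁻¹ • (Submodule.span ℤ (Set.range (Pi.basisFun ℝ ι)) : Set (ι → ℝ)) ↔
      ∀ i, n * x i ∈ Set.range (algebraMap ℤ ℝ) :=
    BoxIntegral.unitPartition.mem_smul_span_iff (n := n)
  have hn' : (n : ℝ) ≠ 0 := by positivity
  rw [Set.mem_inter_iff, key]
  constructor
  · rintro ⟨hx, h⟩
    choose m hm using h
    have hmx : scale n m = x := by
      ext k
      have := hm k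
      simp only [algebraMap_int_eq, Int.coe_castRingHom] at this
      rw [scale, this, inv_mul_cancel_left₀ hn']
    exact ⟨m, by rw [Set.mem_preimage, hmx]; exact hx, hmx⟩
  · rintro ⟨m, hm, rfl⟩
    exact ⟨hm, fun i => ⟨m i, by simp [scale, hn']⟩⟩

/-- The integer points of the dilates of a bounded convex set `s` with two coordinates congruent
modulo `d` have asymptotic density `volume s / d`. -/
theorem tendsto_card_modEq {s : Set (ι → ℝ)} (hb : Bornology.IsBounded s)
    (hm : MeasurableSet s) (hc : Convex ℝ s) {i j : ι} (hij : i ≠ j) {d : ℕ} (hd : d ≠ 0) :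
    Tendsto (fun n : ℕ => (Nat.card {m : ι → ℤ | scale n m ∈ s ∧ (d : ℤ) ∣ m i - m j} : ℝ)
      / n ^ Fintype.card ι) atTop (𝓝 (volume.real s / d)) := by
  classical
  -- `T` replaces the coordinate `x i` by `x j + d * x i`. It has determinant `d` and maps the
  -- integer lattice onto the sublattice `m i ≡ m j` modulo `d`, so the count becomes one over all
  -- integer points of `T ⁻¹' s`.
  let f : Module.Dual ℝ (ι → ℝ) := LinearMap.proj j + ((d : ℝ) - 1) • LinearMap.proj i
  let T : (ι → ℝ) →ₗ[ℝ] (ι → ℝ) := LinearMap.transvection f (Pi.single i 1)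
  have hdet : LinearMap.det T = d := by
    rw [LinearMap.transvection.det]
    simp [f, hij]
  have hd' : (d : ℝ) ≠ 0 := by positivity
  have hdet0 : LinearMap.det T ≠ 0 := by rwa [hdet]
  have hvol : volume.real (T ⁻¹' s) = volume.real s / d := by
    rw [measureReal_def, Measure.addHaar_preimage_linearMap _ hdet0, hdet, ENNReal.toReal_mul,
      ENNReal.toReal_ofReal (abs_nonneg _), abs_of_nonneg (by positivity), measureReal_def]
    ring
  have hb' : Bornology.IsBounded (T ⁻¹' s) :=
    ((T.equivOfDetNeZero hdet0).toContinuousLinearEquiv.antilipschitz).isBounded_preimage hb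
  have hm' : MeasurableSet (T ⁻¹' s) := T.continuous_of_finiteDimensional.measurable hm
  have hfr : volume (frontier (T ⁻¹' s)) = 0 := (hc.linear_preimage T).addHaar_frontier _
  rw [← hvol]
  refine (tendsto_card_div_pow_atTop_volume _ hb' hm' hfr).congr' ?_
  filter_upwards [eventually_ne_atTop 0] with n hn
  congr 2
  rw [card_scale_preimage hn]
  let Tz : (ι → ℤ) → ι → ℤ := fun m => Function.update m i (m j + d * m i)
  have hTz : Function.Injective Tz := by
    intro a b hab
    have h1 : ∀ k, k ≠ i → a k = b k := fun k hk => by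
      have := congrFun hab k
      simpa [Tz, hk] using this
    ext k
    rcases eq_or_ne k i with rfl | hk
    · have h2 := congrFun hab k
      simp only [Tz, Function.update_self, h1 j hij.symm, add_right_inj] at h2
      exact mul_left_cancel₀ (by exact_mod_cast hd) h2
    · exact h1 k hk
  have hcomm : ∀ m, T (scale n m) = scale n (Tz m) := by
    intro m
    ext k
    rcases eq_or_ne k i with rfl | hk
    · simp [T, LinearMap.transvection.apply, f, scale, Tz]
      ring
    · simp [T, LinearMap.transvection.apply, f, scale, Tz, hk]
  rw [← Nat.card_image_of_injective hTz]
  congr 2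
  ext m
  constructor
  · rintro ⟨m', hm', rfl⟩
    refine ⟨by rw [← hcomm]; exact hm', ?_⟩
    simp [Tz, hij.symm]
  · rintro ⟨h1, c, h2⟩
    have hmm : Tz (Function.update m i c) = m := by
      ext k
      rcases eq_or_ne k i with rfl | hk
      · simp [Tz, hij.symm, ← h2]
      · simp [Tz, hk]
    exact ⟨Function.update m i c, by rw [Set.mem_preimage, Set.mem_preimage, hcomm, hmm]; exact h1,
      hmm⟩

variable (ι) in
/-- The integer points of `[-N, N] ^ ι`. -/
noncomputable def box (N : ℕ) : Finset (ι → ℤ) :=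
  open Classical in Fintype.piFinset fun _ => Finset.Icc (-(N : ℤ)) N

theorem card_box (N : ℕ) : (box ι N).card = (2 * N + 1) ^ Fintype.card ι := by
  classical
  rw [box, Fintype.card_piFinset]
  simp only [Int.card_Icc, Finset.prod_const, Finset.card_univ]
  congr 1
  omega

theorem mem_box_iff {N : ℕ} (hN : N ≠ 0) (m : ι → ℤ) :
    m ∈ box ι N ↔ scale N m ∈ Set.Icc (-1 : ι → ℝ) 1 := by
  have hN' : (0 : ℝ) < N := by positivity
  simp only [box, Fintype.mem_piFinset, Finset.mem_Icc, Set.mem_Icc, Pi.le_def, scale,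
    Pi.neg_apply, Pi.one_apply, ← forall_and]
  refine forall_congr' fun k => ?_
  rw [inv_mul_le_iff₀ hN', le_inv_mul_iff₀ hN', mul_one, mul_neg, mul_one]
  norm_cast

/-- Density in the cube of the integer points of a convex cone satisfying a congruence. -/
theorem tendsto_card_cone {S : Set (ι → ℝ)} (hm : MeasurableSet S) (hc : Convex ℝ S)
    (hS : ∀ (c : ℝ), 0 < c → ∀ x, c • x ∈ S ↔ x ∈ S) {i j : ι} (hij : i ≠ j)
    {d : ℕ} (hd : d ≠ 0) :
    Tendsto (fun N : ℕ => (Nat.card {m : ι → ℤ | m ∈ box ι N ∧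
        (fun k => (m k : ℝ)) ∈ S ∧ (d : ℤ) ∣ m i - m j} : ℝ) / (box ι N).card)
      atTop (𝓝 ((cubeMeasure ι).real S / 2 ^ Fintype.card ι / d)) := by
  have h1 := tendsto_card_modEq (s := S ∩ Set.Icc (-1) 1)
    (Metric.isBounded_Icc _ _ |>.subset Set.inter_subset_right)
    (hm.inter measurableSet_Icc) (hc.inter (convex_Icc _ _)) hij hd
  -- This factor changes the normalization from powers of `N` to the number `(2 * N + 1) ^ |ι|` of
  -- points in the box.
  have h2 : Tendsto (fun N : ℕ => ((N : ℝ) / (2 * N + 1 : ℝ)) ^ Fintype.card ι) atTop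
      (𝓝 ((1 / 2) ^ Fintype.card ι)) := by
    refine Tendsto.pow ?_ _
    have h3 : Tendsto (fun N : ℕ => (2 + ((N : ℝ))⁻¹)⁻¹) atTop (𝓝 ((2 + 0)⁻¹)) :=
      (tendsto_const_nhds.add tendsto_inv_atTop_nhds_zero_nat).inv₀ (by norm_num)
    rw [add_zero, ← one_div] at h3
    refine h3.congr' ?_
    filter_upwards [eventually_ne_atTop 0] with N hN
    have : (N : ℝ) ≠ 0 := by positivity
    field_simp
  have h3 := h1.mul h2
  have h4 : volume.real (S ∩ Set.Icc (-1) 1) = (cubeMeasure ι).real S := by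
    rw [cubeMeasure, measureReal_restrict_apply hm]
  have h5 : (cubeMeasure ι).real S / 2 ^ Fintype.card ι / d =
      volume.real (S ∩ Set.Icc (-1) 1) / d * (1 / 2) ^ Fintype.card ι := by
    rw [h4, div_pow, one_pow]; ring
  rw [h5]
  refine h3.congr' ?_
  filter_upwards [eventually_ne_atTop 0] with N hN
  have hN' : (0 : ℝ) < N := by positivity
  have h6 : {m : ι → ℤ | scale N m ∈ S ∩ Set.Icc (-1) 1 ∧ (d : ℤ) ∣ m i - m j} =
      {m : ι → ℤ | m ∈ box ι N ∧ (fun k => (m k : ℝ)) ∈ S ∧ (d : ℤ) ∣ m i - m j} := by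
    ext m
    have h7 : scale N m ∈ S ↔ (fun k => (m k : ℝ)) ∈ S := hS _ (inv_pos.mpr hN') _
    simp only [Set.mem_ofPred_eq, Set.mem_inter_iff, mem_box_iff hN, h7]
    tauto
  rw [h6, card_box, div_pow]
  push_cast
  field_simp

end LatticeCounting

/-! ### Hensel's lemma and the decomposition of nonzero elements. -/

section Hensel

open IsLocalRing

/-- Modulo `I` the difference quotient is the derivative at `w`. This serves both the uniqueness and
the existence of lifted roots. -/
theorem exists_eval_sub_eq {R : Type*} [CommRing R] (I : Ideal R) (g : Polynomial R) {u v w : R}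
    (hu : u - w ∈ I) (hv : v - w ∈ I) :
    ∃ q, g.eval u - g.eval v = q * (u - v) ∧ q - g.derivative.eval w ∈ I := by
  obtain ⟨k, hk⟩ := g.binomExpansion v (u - v)
  refine ⟨g.derivative.eval v + k * (u - v), ?_, ?_⟩
  · rw [add_sub_cancel] at hk
    rw [hk]; ring
  · have h1 : g.derivative.eval v - g.derivative.eval w ∈ I :=
      I.mem_of_dvd (Polynomial.sub_dvd_eval_sub v w _) hv
    have h2 : k * (u - v) ∈ I := I.mul_mem_left _ (by simpa using I.sub_mem hu hv)
    have h3 := I.add_mem h1 h2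
    convert h3 using 1
    ring

theorem eq_of_eval_eq_zero {R : Type*} [CommRing R] [IsLocalRing R] (g : Polynomial R) {u v : R}
    (hu : g.eval u = 0) (hv : g.eval v = 0) (huv : u - v ∈ maximalIdeal R)
    (hd : IsUnit (g.derivative.eval v)) : u = v := by
  obtain ⟨q, hq, hqd⟩ := exists_eval_sub_eq (maximalIdeal R) g huv (w := v) (v := v) (by simp)
  have hqu : IsUnit q := by
    by_contra h
    have h1 : q ∈ maximalIdeal R := (mem_maximalIdeal _).mpr h
    have h2 := (maximalIdeal R).sub_mem h1 hqd
    rw [sub_sub_cancel] at h2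
    exact (mem_maximalIdeal _).mp h2 hd
  rw [hu, hv, sub_zero] at hq
  exact sub_eq_zero.mp ((hqu.mul_right_eq_zero).mp hq.symm)

variable {K : Type*} [NormedField K] [IsUltrametricDist K]

theorem norm_coe_le_one (x : 𝒪[K]) : ‖(x : K)‖ ≤ 1 := x.2

theorem isUnit_iff_norm {x : 𝒪[K]} : IsUnit x ↔ ‖(x : K)‖ = 1 := by
  simpa [← NNReal.coe_inj] using!
    (Valuation.integer.integers (NormedField.valuation (K := K))).isUnit_iff_valuation_eq_one

theorem mem_maximalIdeal_iff_norm {x : 𝒪[K]} : x ∈ 𝓂[K] ↔ ‖(x : K)‖ < 1 := by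
  rw [mem_maximalIdeal, mem_nonunits_iff, isUnit_iff_norm]
  exact ⟨fun h => lt_of_le_of_ne (norm_coe_le_one x) h, fun h => h.ne⟩

theorem norm_le_of_mem_maximalIdeal [IsDiscreteValuationRing 𝒪[K]] {ϖ x : 𝒪[K]}
    (hϖ : Irreducible ϖ) (hx : x ∈ 𝓂[K]) : ‖(x : K)‖ ≤ ‖(ϖ : K)‖ := by
  have hx' : x ∈ Ideal.span {ϖ} := hϖ.maximalIdeal_eq.le hx
  obtain ⟨y, rfl⟩ := Ideal.mem_span_singleton.mp hx'
  simpa using mul_le_of_le_one_right (norm_nonneg (ϖ : K)) (norm_coe_le_one y)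

theorem norm_irreducible_lt_one [IsDiscreteValuationRing 𝒪[K]] {ϖ : 𝒪[K]}
    (hϖ : Irreducible ϖ) : ‖(ϖ : K)‖ < 1 :=
  mem_maximalIdeal_iff_norm.mp (by rw [mem_maximalIdeal]; exact hϖ.not_isUnit)

/-- By discreteness, norm less than `1` means norm at most `‖ϖ‖`, a closed condition. Thus the coset
is complete. -/
theorem isClosed_add_maximalIdeal [IsDiscreteValuationRing 𝒪[K]] (w : 𝒪[K]) :
    IsClosed {x : 𝒪[K] | x - w ∈ 𝓂[K]} := by
  obtain ⟨ϖ, hϖ⟩ := IsDiscreteValuationRing.exists_irreducible 𝒪[K]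
  have : {x : 𝒪[K] | x - w ∈ 𝓂[K]} = {x : 𝒪[K] | ‖((x : K) - w)‖ ≤ ‖(ϖ : K)‖} := by
    ext x
    constructor
    · intro h
      exact norm_le_of_mem_maximalIdeal hϖ h
    · intro h
      exact mem_maximalIdeal_iff_norm.mpr (lt_of_le_of_lt h (norm_irreducible_lt_one hϖ))
  rw [this]
  exact isClosed_le (by fun_prop) continuous_const

/-- Hensel's lemma for (not necessarily monic) polynomials. -/
theorem exists_root_of_isUnit_derivative [CompleteSpace K] [IsDiscreteValuationRing 𝒪[K]]
    (g : Polynomial 𝒪[K]) {w : 𝒪[K]} (hw : g.eval w ∈ 𝓂[K])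
    (hd : IsUnit (g.derivative.eval w)) : ∃ u, g.eval u = 0 ∧ u - w ∈ 𝓂[K] := by
  obtain ⟨ϖ, hϖ⟩ := IsDiscreteValuationRing.exists_irreducible 𝒪[K]
  obtain ⟨c, hc⟩ := hd
  let s : Set 𝒪[K] := {x | x - w ∈ 𝓂[K]}
  -- Newton's map with the derivative frozen at `w`. It contracts the coset of `w` by the factor
  -- `‖ϖ‖`, and its fixed points are the roots of `g`.
  let f : 𝒪[K] → 𝒪[K] := fun x => x - (↑c⁻¹ : 𝒪[K]) * g.eval x
  have hkey : ∀ x ∈ s, ∀ y ∈ s, ∃ r ∈ 𝓂[K], f x - f y = r * (x - y) := by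
    intro x hx y hy
    obtain ⟨q, hq, hqd⟩ := exists_eval_sub_eq 𝓂[K] g hx hy
    refine ⟨-(↑c⁻¹ * (q - g.derivative.eval w)), neg_mem (Ideal.mul_mem_left _ _ hqd), ?_⟩
    rw [← hc]
    have h1 : (↑c⁻¹ : 𝒪[K]) * ↑c = 1 := c.inv_mul
    simp only [f]
    linear_combination (-(↑c⁻¹ : 𝒪[K])) * hq - (x - y) * h1
  have hws : w ∈ s := by simp [s]
  have hmaps : Set.MapsTo f s s := by
    intro x hx
    obtain ⟨r, hr, hrx⟩ := hkey x hx w hws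
    have h1 : f x - w = r * (x - w) + -(↑c⁻¹ * g.eval w) := by
      rw [← hrx]; simp only [f]; ring
    change f x - w ∈ 𝓂[K]
    rw [h1]
    exact add_mem (Ideal.mul_mem_left _ _ hx) (neg_mem (Ideal.mul_mem_left _ _ hw))
  have hcompl : IsComplete s := by
    have : CompleteSpace 𝒪[K] := (Valued.isClosed_integer K).completeSpace_coe
    exact (isClosed_add_maximalIdeal w).isComplete
  have hcontr : ContractingWith ‖(ϖ : K)‖₊ (hmaps.restrict f s s) := by
    refine ⟨by exact_mod_cast norm_irreducible_lt_one hϖ, ?_⟩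
    refine LipschitzWith.of_dist_le_mul fun x y => ?_
    obtain ⟨r, hr, hrx⟩ := hkey x x.2 y y.2
    have h1 : dist (hmaps.restrict f s s x) (hmaps.restrict f s s y)
        = ‖((f x : 𝒪[K]) : K) - (f y : 𝒪[K])‖ := dist_eq_norm (f x : K) (f y : K)
    have h2 : dist x y = ‖((x : 𝒪[K]) : K) - (y : 𝒪[K])‖ := dist_eq_norm ((x : 𝒪[K]) : K) _
    have h3 : ((f x : 𝒪[K]) : K) - (f y : 𝒪[K]) = (r : K) * (((x : 𝒪[K]) : K) - (y : 𝒪[K])) := by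
      exact_mod_cast congrArg (fun z : 𝒪[K] => (z : K)) hrx
    rw [h1, h2, h3, norm_mul]
    exact mul_le_mul_of_nonneg_right (norm_le_of_mem_maximalIdeal hϖ hr) (norm_nonneg _)
  obtain ⟨u, hu, hfix, -⟩ := hcontr.exists_fixedPoint' hcompl hmaps hws (edist_ne_top _ _)
  refine ⟨u, ?_, hu⟩
  have h1 : (↑c⁻¹ : 𝒪[K]) * g.eval u = 0 := by
    have h2 : u - (↑c⁻¹ : 𝒪[K]) * g.eval u = u := hfix
    exact sub_eq_self.mp h2
  exact (c⁻¹.isUnit.mul_right_eq_zero).mp h1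

theorem exists_eq_zpow_mul [IsDiscreteValuationRing 𝒪[K]] {ϖ : 𝒪[K]} (hϖ : Irreducible ϖ)
    (x : Kˣ) : ∃ (m : ℤ) (u : 𝒪[K]ˣ), (x : K) = (ϖ : K) ^ m * ((u : 𝒪[K]) : K) := by
  have aux : ∀ y : K, y ≠ 0 → ‖y‖ ≤ 1 → ∃ (m : ℤ) (u : 𝒪[K]ˣ),
      y = (ϖ : K) ^ m * ((u : 𝒪[K]) : K) := by
    intro y hy0 hy
    obtain ⟨n, u, h⟩ := IsDiscreteValuationRing.eq_unit_mul_pow_irreducible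
      (x := (⟨y, hy⟩ : 𝒪[K])) (fun h => hy0 (congrArg Subtype.val h)) hϖ
    refine ⟨n, u, ?_⟩
    have := congrArg (fun z : 𝒪[K] => (z : K)) h
    simp only [Subring.coe_mul, SubmonoidClass.coe_pow] at this
    rw [zpow_natCast, this, mul_comm]
  rcases le_total ‖(x : K)‖ 1 with h | h
  · exact aux _ x.ne_zero h
  · obtain ⟨m, u, hm⟩ := aux (x : K)⁻¹ (inv_ne_zero x.ne_zero) (by
      rw [norm_inv]; exact inv_le_one_of_one_le₀ h)
    refine ⟨-m, u⁻¹, ?_⟩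
    have hu : ((u : 𝒪[K]) : K) * (((u⁻¹ : 𝒪[K]ˣ) : 𝒪[K]) : K) = 1 := by
      exact_mod_cast congrArg (fun z : 𝒪[K] => (z : K)) u.mul_inv
    rw [← inv_inv (x : K), hm, mul_inv, zpow_neg, eq_inv_of_mul_eq_one_left
      ((mul_comm _ _).trans hu)]

theorem zpow_mul_unit_inj [IsDiscreteValuationRing 𝒪[K]] {ϖ : 𝒪[K]} (hϖ : Irreducible ϖ)
    {m n : ℤ} {u v : 𝒪[K]ˣ}
    (h : (ϖ : K) ^ m * ((u : 𝒪[K]) : K) = (ϖ : K) ^ n * ((v : 𝒪[K]) : K)) : m = n ∧ u = v := by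
  have h0 : (ϖ : K) ≠ 0 := fun h => hϖ.ne_zero (Subtype.ext h)
  have hmn : m = n := by
    have h1 := congrArg norm h
    rw [norm_mul, norm_mul, isUnit_iff_norm.mp u.isUnit, isUnit_iff_norm.mp v.isUnit, mul_one,
      mul_one, norm_zpow, norm_zpow] at h1
    exact zpow_right_injective₀ (norm_pos_iff.mpr h0) (norm_irreducible_lt_one hϖ).ne h1
  subst hmn
  exact ⟨rfl, Units.ext (Subtype.ext (mul_left_cancel₀ (zpow_ne_zero _ h0) h))⟩

end Hensel

/-! ### Roots of a given valuation, by reduction to the residue field. -/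

section Roots

open IsLocalRing Polynomial

variable {𝒜 : Finset ℤ}

/-- The polynomial `∑ b γ X ^ (γ - o)`. -/
noncomputable def shiftPoly {R : Type*} [CommRing R] (o : ℤ) (b : 𝒜 → R) : R[X] :=
  ∑ γ : 𝒜, C (b γ) * X ^ ((γ : ℤ) - o).toNat

theorem eval_shiftPoly {R : Type*} [CommRing R] (o : ℤ) (b : 𝒜 → R) (x : R) :
    (shiftPoly o b).eval x = ∑ γ : 𝒜, b γ * x ^ ((γ : ℤ) - o).toNat := by
  simp [shiftPoly, eval_finsetSum]

theorem map_shiftPoly {R S : Type*} [CommRing R] [CommRing S] (f : R →+* S) (o : ℤ) (b : 𝒜 → R) :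
    (shiftPoly o b).map f = shiftPoly o fun γ => f (b γ) := by
  simp [shiftPoly, Polynomial.map_sum]

theorem shiftPoly_ne_zero {R : Type*} [CommRing R] {o : ℤ} (ho : ∀ γ ∈ 𝒜, o ≤ γ) {b : 𝒜 → R}
    {γ : 𝒜} (hγ : b γ ≠ 0) : shiftPoly o b ≠ 0 := by
  intro h
  have h1 : (shiftPoly o b).coeff ((γ : ℤ) - o).toNat = b γ := by
    rw [shiftPoly, finsetSum_coeff, Finset.sum_eq_single γ]
    · simp
    · intro δ _ hδ
      rw [coeff_C_mul_X_pow, if_neg]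
      intro h
      have h1 := ho γ γ.2
      have h2 := ho δ δ.2
      exact hδ (Subtype.ext (by omega))
    · simp
  rw [h, coeff_zero] at h1
  exact hγ h1.symm

theorem natDegree_shiftPoly_le {R : Type*} [CommRing R] (o : ℤ) (b : 𝒜 → R) :
    (shiftPoly o b).natDegree ≤ ∑ γ : 𝒜, ((γ : ℤ) - o).toNat := by
  refine natDegree_sum_le_of_forall_le _ _ fun γ _ => ?_
  exact (natDegree_C_mul_X_pow_le _ _).trans
    (Finset.single_le_sum (f := fun γ : 𝒜 => ((γ : ℤ) - o).toNat) (fun _ _ => Nat.zero_le _)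
      (Finset.mem_univ γ))

theorem zpow_eq_mul_pow_toNat {F : Type*} [Field F] {x : F} (hx : x ≠ 0) {o γ : ℤ} (h : o ≤ γ) :
    x ^ γ = x ^ o * x ^ (γ - o).toNat := by
  rw [← zpow_natCast, Int.toNat_of_nonneg (by omega), ← zpow_add₀ hx]
  congr 1; ring

theorem exists_lower_bound (𝒜 : Finset ℤ) : ∃ o : ℤ, ∀ γ ∈ 𝒜, o ≤ γ := by
  obtain ⟨o, ho⟩ := 𝒜.finite_toSet.bddBelow
  exact ⟨o, fun γ hγ => ho hγ⟩

theorem mem_zeroSet_iff {K : Type*} [NormedField K] (a : 𝒜 → K) (x : Kˣ) :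
    x ∈ zeroSet (poly 𝒜 a) ↔ ∑ γ : 𝒜, a γ * (x : K) ^ (γ : ℤ) = 0 := by
  simp [zeroSet, poly, LaurentPolynomial.eval₂_C_mul_T]

/-- A crude degree bound, used only on the rare collinear configurations. Uniformity in the
coefficients is what matters. -/
theorem encard_zeroSet_le {K : Type*} [NormedField K] {o : ℤ} (ho : ∀ γ ∈ 𝒜, o ≤ γ)
    {a : 𝒜 → K} {γ : 𝒜} (hγ : a γ ≠ 0) :
    (zeroSet (poly 𝒜 a)).encard ≤ (∑ γ : 𝒜, ((γ : ℤ) - o).toNat : ℕ) := by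
  classical
  have hP := shiftPoly_ne_zero ho hγ
  have hsub : (fun x : Kˣ => (x : K)) '' zeroSet (poly 𝒜 a)
      ⊆ ((shiftPoly o a).roots.toFinset : Set K) := by
    rintro _ ⟨x, hx, rfl⟩
    rw [mem_zeroSet_iff] at hx
    rw [Finset.mem_coe, Multiset.mem_toFinset, mem_roots hP, IsRoot.def, eval_shiftPoly]
    have h1 : (x : K) ^ o * ∑ γ : 𝒜, a γ * (x : K) ^ ((γ : ℤ) - o).toNat = 0 := by
      rw [← hx, Finset.mul_sum]
      refine Finset.sum_congr rfl fun γ _ => ?_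
      rw [zpow_eq_mul_pow_toNat x.ne_zero (ho γ γ.2)]
      ring
    exact (mul_eq_zero.mp h1).resolve_left (zpow_ne_zero _ x.ne_zero)
  rw [← Units.val_injective.encard_image (zeroSet (poly 𝒜 a))]
  refine (Set.encard_le_encard hsub).trans ?_
  rw [Set.encard_coe_eq_coe_finsetCard]
  exact_mod_cast (Multiset.toFinset_card_le _).trans ((card_roots' _).trans
    (natDegree_shiftPoly_le o a))

theorem encard_pow_eq {F : Type*} [Field F] [IsAlgClosed F] {d : ℕ} (hd : (d : F) ≠ 0) {θ : F}
    (hθ : θ ≠ 0) : {ζ : F | ζ ^ d = θ}.encard = d := by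
  classical
  have hd0 : 0 < d := Nat.pos_of_ne_zero fun h => hd (by simp [h])
  have hsep := separable_X_pow_sub_C θ hd hθ
  have hset : {ζ : F | ζ ^ d = θ} = ((X ^ d - C θ : F[X]).roots.toFinset : Set F) := by
    ext ζ
    simp [mem_roots (X_pow_sub_C_ne_zero hd0 θ), sub_eq_zero]
  rw [hset, Set.encard_coe_eq_coe_finsetCard,
    Multiset.toFinset_card_of_nodup (nodup_roots hsep),
    ← (IsAlgClosed.splits _).natDegree_eq_card_roots, natDegree_X_pow_sub_C]

variable {K : Type*} [NormedField K] [IsUltrametricDist K]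

/-- The polynomial over the valuation ring obtained from `∑ ϖ ^ n γ * w γ * X ^ γ` by the
substitution `X = ϖ ^ m * Y` and division by `ϖ ^ c * Y ^ o`. -/
noncomputable def reducedPoly (ϖ : 𝒪[K]) (n : 𝒜 → ℤ) (w : 𝒜 → 𝒪[K]ˣ) (o m c : ℤ) : 𝒪[K][X] :=
  shiftPoly o fun γ => (w γ : 𝒪[K]) * ϖ ^ (n γ + m * γ - c).toNat

variable {ϖ : 𝒪[K]} {n : 𝒜 → ℤ} {w : 𝒜 → 𝒪[K]ˣ} {o m c : ℤ}

theorem coe_unit_ne_zero (u : 𝒪[K]ˣ) : ((u : 𝒪[K]) : K) ≠ 0 := fun h => by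
  have := isUnit_iff_norm.mp u.isUnit
  simp [h] at this

theorem sum_eq_reducedPoly_eval (hϖ : (ϖ : K) ≠ 0) (ho : ∀ γ ∈ 𝒜, o ≤ γ)
    (hc : ∀ γ : 𝒜, c ≤ n γ + m * γ) (u : 𝒪[K]ˣ) :
    ∑ γ : 𝒜, (ϖ : K) ^ n γ * ((w γ : 𝒪[K]) : K) * ((ϖ : K) ^ m * ((u : 𝒪[K]) : K)) ^ (γ : ℤ)
      = (ϖ : K) ^ c * ((u : 𝒪[K]) : K) ^ o *
        (((reducedPoly ϖ n w o m c).eval (u : 𝒪[K]) : 𝒪[K]) : K) := by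
  rw [reducedPoly, eval_shiftPoly]
  push_cast
  rw [Finset.mul_sum]
  refine Finset.sum_congr rfl fun γ _ => ?_
  have h1 : (ϖ : K) ^ (n γ + m * γ) = (ϖ : K) ^ c * (ϖ : K) ^ (n γ + m * γ - c).toNat :=
    zpow_eq_mul_pow_toNat hϖ (hc γ)
  have h2 := zpow_eq_mul_pow_toNat (coe_unit_ne_zero u) (ho γ γ.2)
  rw [mul_zpow, h2, ← zpow_mul]
  rw [zpow_add₀ hϖ] at h1
  linear_combination ((w γ : 𝒪[K]) : K) * (((u : 𝒪[K]) : K) ^ o *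
    ((u : 𝒪[K]) : K) ^ ((γ : ℤ) - o).toNat) * h1

theorem mem_zeroSet_iff_reducedPoly (hϖ : (ϖ : K) ≠ 0) (ho : ∀ γ ∈ 𝒜, o ≤ γ)
    (hc : ∀ γ : 𝒜, c ≤ n γ + m * γ) {x : Kˣ} {u : 𝒪[K]ˣ}
    (hx : (x : K) = (ϖ : K) ^ m * ((u : 𝒪[K]) : K)) :
    x ∈ zeroSet (poly 𝒜 fun γ => (ϖ : K) ^ n γ * ((w γ : 𝒪[K]) : K)) ↔
      (reducedPoly ϖ n w o m c).eval (u : 𝒪[K]) = 0 := by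
  rw [mem_zeroSet_iff, hx, sum_eq_reducedPoly_eval hϖ ho hc, mul_eq_zero, or_iff_right]
  · exact ZeroMemClass.coe_eq_zero
  · exact mul_ne_zero (zpow_ne_zero _ hϖ) (zpow_ne_zero _ (coe_unit_ne_zero u))

theorem residue_mul_pow_toNat [IsDiscreteValuationRing 𝒪[K]] (hϖ : Irreducible ϖ)
    (v : 𝒪[K]) {e : ℤ} (he : 0 ≤ e) :
    residue 𝒪[K] (v * ϖ ^ e.toNat) = if e = 0 then residue 𝒪[K] v else 0 := by
  split_ifs with h
  · simp [h]
  · have h1 : residue 𝒪[K] ϖ = 0 := (residue_eq_zero_iff ϖ).mpr hϖ.not_isUnit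
    have h2 : e.toNat ≠ 0 := by omega
    rw [map_mul, map_pow, h1, zero_pow h2, mul_zero]

/-- The other monomials keep a positive power of `ϖ`, which dies in the residue field. -/
theorem eval_map_reducedPoly [IsDiscreteValuationRing 𝒪[K]] (hϖ : Irreducible ϖ)
    (hc : ∀ γ : 𝒜, c ≤ n γ + m * γ) :
    (reducedPoly ϖ n w o m c).map (residue 𝒪[K]) = shiftPoly o fun γ =>
      if n γ + m * γ = c then residue 𝒪[K] (w γ) else 0 := by
  rw [reducedPoly, map_shiftPoly]
  congr 1
  ext γ
  rw [residue_mul_pow_toNat hϖ _ (by linarith [hc γ])]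
  simp only [sub_eq_zero]

/-- At the valuation of a root, the minimum of the valuations of the monomials is attained
twice. -/
theorem exists_two_minimizers [IsDiscreteValuationRing 𝒪[K]] (hϖ : Irreducible ϖ)
    [Nonempty 𝒜] {x : Kˣ} {u : 𝒪[K]ˣ} (hx : (x : K) = (ϖ : K) ^ m * ((u : 𝒪[K]) : K))
    (hroot : x ∈ zeroSet (poly 𝒜 fun γ => (ϖ : K) ^ n γ * ((w γ : 𝒪[K]) : K))) :
    ∃ α β : 𝒜, α < β ∧ n α + m * α = n β + m * β ∧ ∀ γ : 𝒜, n α + m * α ≤ n γ + m * γ := by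
  obtain ⟨o, ho⟩ := exists_lower_bound 𝒜
  obtain ⟨α, hα⟩ := Finite.exists_min fun γ : 𝒜 => n γ + m * γ
  have h0 : (ϖ : K) ≠ 0 := fun h => hϖ.ne_zero (Subtype.ext h)
  suffices h : ∃ β : 𝒜, β ≠ α ∧ n α + m * α = n β + m * β by
    obtain ⟨β, hβ, h⟩ := h
    rcases lt_or_gt_of_ne hβ with h1 | h1
    · exact ⟨β, α, h1, h.symm, fun γ => h ▸ hα γ⟩
    · exact ⟨α, β, h1, h, hα⟩
  -- With a single minimizer, the reduction is one monomial with a unit coefficient, which cannot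
  -- vanish at a unit.
  by_contra! hne
  have h1 := (mem_zeroSet_iff_reducedPoly h0 ho hα hx).mp hroot
  have h2 : ((reducedPoly ϖ n w o m (n α + m * α)).map (residue 𝒪[K])).eval
      (residue 𝒪[K] u) = 0 := by
    rw [eval_map_apply, h1, map_zero]
  rw [eval_map_reducedPoly hϖ hα, eval_shiftPoly, Finset.sum_eq_single α] at h2
  · rw [if_pos rfl] at h2
    have hw : IsUnit (residue 𝒪[K] (w α)) := (w α).isUnit.map _
    have hu : IsUnit (residue 𝒪[K] u) := u.isUnit.map _
    exact (hw.mul (hu.pow _)).ne_zero h2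
  · intro β _ hβ
    rw [if_neg fun h => hne β hβ h.symm, zero_mul]
  · simp

/-- The roots of valuation `m`. -/
def rootsOfValuation (ϖ : 𝒪[K]) (n : 𝒜 → ℤ) (w : 𝒜 → 𝒪[K]ˣ) (m : ℤ) : Set Kˣ :=
  {x ∈ zeroSet (poly 𝒜 fun γ => (ϖ : K) ^ n γ * ((w γ : 𝒪[K]) : K)) |
    ∃ u : 𝒪[K]ˣ, (x : K) = (ϖ : K) ^ m * ((u : 𝒪[K]) : K)}

/-- If the minimum of the valuations of the monomials is attained exactly at `α` and `β`, there
are `β - α` roots. -/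
theorem encard_rootsOfValuation [CompleteSpace K] [IsDiscreteValuationRing 𝒪[K]]
    [IsAlgClosed 𝓀[K]] (hϖ : Irreducible ϖ) {α β : 𝒜} (hαβ : α < β)
    (hd : ((((β : ℤ) - α).toNat : ℕ) : 𝓀[K]) ≠ 0)
    (heq : n α + m * α = n β + m * β)
    (hlt : ∀ γ : 𝒜, γ ≠ α → γ ≠ β → n α + m * α < n γ + m * γ) :
    (rootsOfValuation ϖ n w m).encard = (((β : ℤ) - α).toNat : ℕ) := by
  obtain ⟨o, ho⟩ := exists_lower_bound 𝒜
  have h0 : (ϖ : K) ≠ 0 := fun h => hϖ.ne_zero (Subtype.ext h)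
  have hle : ∀ γ : 𝒜, n α + m * α ≤ n γ + m * γ := by
    intro γ
    by_cases h1 : γ = α
    · rw [h1]
    by_cases h2 : γ = β
    · rw [h2, heq]
    exact (hlt γ h1 h2).le
  have hαβ' : (α : ℤ) < β := hαβ
  set g := reducedPoly ϖ n w o m (n α + m * α) with hg
  set d := ((β : ℤ) - α).toNat with hd_def
  set a := ((α : ℤ) - o).toNat with ha_def
  have hb : ((β : ℤ) - o).toNat = a + d := by
    have := ho α α.2
    omega
  set wα := residue 𝒪[K] (w α) with hwα
  set wβ := residue 𝒪[K] (w β) with hwβ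
  have hwα0 : wα ≠ 0 := ((w α).isUnit.map _).ne_zero
  have hwβ0 : wβ ≠ 0 := ((w β).isUnit.map _).ne_zero
  have hgmap : g.map (residue 𝒪[K]) = C wα * X ^ a + C wβ * X ^ (a + d) := by
    rw [hg, eval_map_reducedPoly hϖ hle, shiftPoly, ← hb]
    rw [← Finset.sum_subset (Finset.subset_univ {α, β}), Finset.sum_pair hαβ.ne]
    · rw [if_pos rfl, if_pos heq.symm]
    · intro γ _ hγ
      simp only [Finset.mem_insert, Finset.mem_singleton, not_or] at hγ
      rw [if_neg (hlt γ hγ.1 hγ.2).ne', C_0, zero_mul]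
  have hroot_iff : ∀ ζ : 𝓀[K], ζ ≠ 0 →
      ((g.map (residue 𝒪[K])).eval ζ = 0 ↔ ζ ^ d = -wα / wβ) := by
    intro ζ hζ
    rw [hgmap, eq_div_iff hwβ0]
    simp only [eval_add, eval_mul, eval_C, eval_pow, eval_X]
    constructor
    · intro h
      have h1 : ζ ^ a * (wα + wβ * ζ ^ d) = 0 := by rw [← h]; ring
      have h2 := (mul_eq_zero.mp h1).resolve_left (pow_ne_zero _ hζ)
      linear_combination h2
    · intro h
      linear_combination ζ ^ a * h
  have hder : ∀ ζ : 𝓀[K], ζ ≠ 0 → (g.map (residue 𝒪[K])).eval ζ = 0 →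
      (g.map (residue 𝒪[K])).derivative.eval ζ ≠ 0 := by
    intro ζ hζ hz hz'
    rw [hgmap] at hz hz'
    simp only [derivative_add, derivative_C_mul, derivative_X_pow, eval_add, eval_mul, eval_C,
      eval_pow, eval_X] at hz hz'
    -- For `k = 0` the truncated exponent is harmless, since the factor `k` vanishes. The identity
    -- gives `ζ * g' - a * g = d * wβ * ζ ^ (a + d)` for the reduced `g`, so a double root would
    -- force `d = 0` in the residue field.
    have e1 : ∀ k : ℕ, (k : 𝓀[K]) * ζ ^ (k - 1) * ζ = k * ζ ^ k := by
      intro k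
      rcases k with _ | k
      · simp
      · rw [Nat.add_sub_cancel, pow_succ]; ring
    have h1 : (d : 𝓀[K]) * (wβ * ζ ^ (a + d)) = 0 := by
      have e2 := e1 a
      have e3 := e1 (a + d)
      push_cast at e3 hz'
      linear_combination ζ * hz' - wα * e2 - wβ * e3 - (a : 𝓀[K]) * hz
    exact mul_ne_zero hd (mul_ne_zero hwβ0 (pow_ne_zero _ hζ)) h1
  have hres : ∀ u : 𝒪[K], (g.map (residue 𝒪[K])).eval (residue 𝒪[K] u)
      = residue 𝒪[K] (g.eval u) := fun u => eval_map_apply _ _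
  have hres' : ∀ u : 𝒪[K], (g.map (residue 𝒪[K])).derivative.eval (residue 𝒪[K] u)
      = residue 𝒪[K] (g.derivative.eval u) := fun u => by
    rw [derivative_map, eval_map_apply]
  have hunit : ∀ u : 𝒪[K], residue 𝒪[K] u ≠ 0 → g.eval u ∈ 𝓂[K] →
      IsUnit (g.derivative.eval u) := by
    intro u hu hgu
    have h1 := hder _ hu (by rw [hres]; exact (residue_eq_zero_iff _).mpr hgu)
    rw [hres'] at h1
    exact (residue_ne_zero_iff_isUnit _).mp h1
  let Z : Set 𝒪[K]ˣ := {u | g.eval (u : 𝒪[K]) = 0}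
  have hϖu : ∀ u : 𝒪[K]ˣ, (ϖ : K) ^ m * ((u : 𝒪[K]) : K) ≠ 0 := fun u =>
    mul_ne_zero (zpow_ne_zero _ h0) (coe_unit_ne_zero u)
  let F : 𝒪[K]ˣ → Kˣ := fun u => Units.mk0 _ (hϖu u)
  have hF : Function.Injective F := by
    intro u v huv
    exact (zpow_mul_unit_inj hϖ (congrArg Units.val huv)).2
  have hFZ : rootsOfValuation ϖ n w m = F '' Z := by
    ext x
    constructor
    · rintro ⟨hx, u, hu⟩
      exact ⟨u, (mem_zeroSet_iff_reducedPoly h0 ho hle hu).mp hx, Units.ext hu.symm⟩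
    · rintro ⟨u, hu, rfl⟩
      exact ⟨(mem_zeroSet_iff_reducedPoly h0 ho hle rfl).mpr hu, u, rfl⟩
  let ρ : 𝒪[K]ˣ → 𝓀[K] := fun u => residue 𝒪[K] (u : 𝒪[K])
  have hρ0 : ∀ u, ρ u ≠ 0 := fun u => (u.isUnit.map _).ne_zero
  have hρinj : Set.InjOn ρ Z := by
    intro u hu v hv huv
    refine Units.ext (eq_of_eval_eq_zero g hu hv ?_ (hunit _ (hρ0 v) ?_))
    · exact (residue_eq_zero_iff _).mp (by rw [map_sub]; exact sub_eq_zero.mpr huv)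
    · have hv' : g.eval (v : 𝒪[K]) = 0 := hv
      rw [hv']; exact zero_mem _
  -- Reduction is a bijection from the unit roots onto the solutions of the binomial equation;
  -- surjectivity is Hensel's lemma.
  have hρimg : ρ '' Z = {ζ : 𝓀[K] | ζ ^ d = -wα / wβ} := by
    ext ζ
    constructor
    · rintro ⟨u, hu, rfl⟩
      refine (hroot_iff _ (hρ0 u)).mp ?_
      have hu' : g.eval (u : 𝒪[K]) = 0 := hu
      rw [hres, hu', map_zero]
    · intro hζ
      replace hζ : ζ ^ d = -wα / wβ := hζ
      have hζ0 : ζ ≠ 0 := by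
        rintro rfl
        rw [zero_pow (by omega)] at hζ
        exact div_ne_zero (neg_ne_zero.mpr hwα0) hwβ0 hζ.symm
      obtain ⟨v, rfl⟩ := residue_surjective ζ
      have hv1 := (hroot_iff _ hζ0).mpr hζ
      rw [hres] at hv1
      have hv2 : g.eval v ∈ 𝓂[K] := (residue_eq_zero_iff _).mp hv1
      obtain ⟨u, hu, huv⟩ := exists_root_of_isUnit_derivative g hv2 (hunit v hζ0 hv2)
      have huv' : residue 𝒪[K] u = residue 𝒪[K] v := by
        rw [← sub_eq_zero, ← map_sub]
        exact (residue_eq_zero_iff _).mpr huv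
      have huu : IsUnit u := (residue_ne_zero_iff_isUnit u).mp (by rw [huv']; exact hζ0)
      exact ⟨huu.unit, hu, huv'⟩
  rw [hFZ, hF.encard_image, ← hρinj.encard_image, hρimg]
  exact encard_pow_eq hd (div_ne_zero (neg_ne_zero.mpr hwα0) hwβ0)

end Roots

/-! ### The number of roots as the length of the integral lower edges. -/

section EdgeCount

variable {𝒜 : Finset ℤ}

/-- The exponents as real numbers. -/
def position (γ : 𝒜) : ℝ := ((γ : ℤ) : ℝ)

theorem position_injective : Function.Injective (position : 𝒜 → ℝ) := by
  intro α β h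
  exact Subtype.ext (Int.cast_injective (α := ℝ) h)

theorem position_lt_iff {α β : 𝒜} : position α < position β ↔ α < β := by
  rw [← Subtype.coe_lt_coe]
  exact Int.cast_lt

/-- The valuations `n` for which `α`, `β` span a lower edge of integral slope. -/
def integralEdgeSet (α β : 𝒜) : Set (𝒜 → ℤ) :=
  {n | (fun k => (n k : ℝ)) ∈ edgeSet position α β ∧ ((((β : ℤ) - α).toNat : ℕ) : ℤ) ∣ n α - n β}

/-- The valuations `n` for which the points of index `α`, `β`, `γ` are collinear. -/
def integralCollinearSet (α β γ : 𝒜) : Set (𝒜 → ℤ) :=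
  {n | (fun k => (n k : ℝ)) ∈ collinearSet position α β γ}

variable (𝒜) in
/-- Pairs of increasing exponents. -/
noncomputable def increasingPairs : Finset (𝒜 × 𝒜) :=
  Finset.univ.filter fun q => position q.1 < position q.2

variable (𝒜) in
/-- Triples of distinct exponents. -/
noncomputable def distinctTriples : Finset (𝒜 × 𝒜 × 𝒜) :=
  Finset.univ.filter fun q => q.1 ≠ q.2.1 ∧ q.2.2 ≠ q.1 ∧ q.2.2 ≠ q.2.1

/-- The divisibility condition says exactly that the `m` balancing the monomials at `α` and `β` is
an integer. The height of a point above the edge is then the excess of `n γ + m * γ` over the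
minimum. -/
theorem mem_integralEdgeSet_iff {α β : 𝒜} (hαβ : α < β) {n : 𝒜 → ℤ} :
    n ∈ integralEdgeSet α β ↔ ∃ m : ℤ, n α + m * α = n β + m * β ∧
      ∀ γ : 𝒜, γ ≠ α → γ ≠ β → n α + m * α < n γ + m * γ := by
  have hαβ' : (α : ℤ) < β := hαβ
  have hd : ((((β : ℤ) - α).toNat : ℕ) : ℤ) = β - α := Int.toNat_of_nonneg (by omega)
  have hedge : (fun k => (n k : ℝ)) ∈ edgeSet position α β ↔ ∀ γ : 𝒜, γ ≠ α → γ ≠ β →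
      n α * ((β : ℤ) - γ) + n β * ((γ : ℤ) - α) < n γ * ((β : ℤ) - α) := by
    refine forall_congr' fun γ => forall_congr' fun _ => forall_congr' fun _ => ?_
    simp only [position]
    norm_cast
  have hline : ∀ m : ℤ, n α + m * α = n β + m * β → ∀ γ : 𝒜,
      (n α * ((β : ℤ) - γ) + n β * ((γ : ℤ) - α) < n γ * ((β : ℤ) - α) ↔
        n α + m * α < n γ + m * γ) := by
    intro m hm γ
    have h1 : n γ * ((β : ℤ) - α) - (n α * ((β : ℤ) - γ) + n β * ((γ : ℤ) - α))
        = (n γ + m * γ - (n α + m * α)) * ((β : ℤ) - α) := by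
      linear_combination ((γ : ℤ) - α) * hm
    rw [← sub_pos, h1, mul_pos_iff_of_pos_right (by omega), sub_pos]
  constructor
  · rintro ⟨h1, h2⟩
    rw [hd] at h2
    obtain ⟨m, hm⟩ := h2
    have hm' : n α + m * α = n β + m * β := by linear_combination hm
    exact ⟨m, hm', fun γ hα hβ => (hline m hm' γ).mp (hedge.mp h1 γ hα hβ)⟩
  · rintro ⟨m, hm, h⟩
    refine ⟨hedge.mpr fun γ hα hβ => (hline m hm γ).mpr (h γ hα hβ), ?_⟩
    rw [hd]
    exact ⟨m, by linear_combination hm⟩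

theorem mem_integralCollinearSet {n : 𝒜 → ℤ} {m : ℤ} {α β γ : 𝒜}
    (h₁ : n α + m * α = n β + m * β) (h₂ : n α + m * α = n γ + m * γ) :
    n ∈ integralCollinearSet α β γ := by
  have h1 : (n α : ℝ) + m * (α : ℤ) = n β + m * (β : ℤ) := by exact_mod_cast h₁
  have h2 : (n α : ℝ) + m * (α : ℤ) = n γ + m * (γ : ℤ) := by exact_mod_cast h₂
  simp only [integralCollinearSet, collinearSet, position, Set.mem_ofPred_eq]
  linear_combination (((β : ℤ) : ℝ) - (α : ℤ)) * h2 - (((γ : ℤ) : ℝ) - (α : ℤ)) * h1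

variable {K : Type*} [NormedField K] [IsUltrametricDist K] [CompleteSpace K]
  [IsDiscreteValuationRing 𝒪[K]] [IsAlgClosed 𝓀[K]] {ϖ : 𝒪[K]}

open Classical in
/-- The total length of the lower edges of integral slope. -/
noncomputable def edgeLength (n : 𝒜 → ℤ) : ℕ :=
  ∑ q ∈ increasingPairs 𝒜 with n ∈ integralEdgeSet q.1 q.2, ((q.2 : ℤ) - q.1).toNat

/-- The hypotheses stand inside the existential so that `choose` yields a slope for every pair. -/
theorem exists_slope_of_mem {n : 𝒜 → ℤ} (q : 𝒜 × 𝒜) : ∃ m : ℤ,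
    q.1 < q.2 → n ∈ integralEdgeSet q.1 q.2 → (n q.1 + m * q.1 = n q.2 + m * q.2 ∧
      ∀ γ : 𝒜, γ ≠ q.1 → γ ≠ q.2 → n q.1 + m * q.1 < n γ + m * γ) := by
  by_cases h : q.1 < q.2 ∧ n ∈ integralEdgeSet q.1 q.2
  · obtain ⟨m, hm⟩ := (mem_integralEdgeSet_iff h.1).mp h.2
    exact ⟨m, fun _ _ => hm⟩
  · exact ⟨0, fun h1 h2 => absurd ⟨h1, h2⟩ h⟩

/-- This direction needs no genericity: distinct lower edges have distinct slopes, so their roots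
have distinct valuations. -/
theorem edgeLength_le_encard (hϖ : Irreducible ϖ) (n : 𝒜 → ℤ) (w : 𝒜 → 𝒪[K]ˣ)
    (hchar : ∀ α β : 𝒜, α < β → ((((β : ℤ) - α).toNat : ℕ) : 𝓀[K]) ≠ 0) :
    (edgeLength n : ℕ∞) ≤
      (zeroSet (poly 𝒜 fun γ => (ϖ : K) ^ n γ * ((w γ : 𝒪[K]) : K))).encard := by
  classical
  choose m hm using exists_slope_of_mem (n := n)
  set P := (increasingPairs 𝒜).filter fun q => n ∈ integralEdgeSet q.1 q.2 with hP
  have hPmem : ∀ q ∈ P, q.1 < q.2 ∧ n ∈ integralEdgeSet q.1 q.2 := by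
    intro q hq
    simpa [P, increasingPairs, position_lt_iff] using hq
  have hcard : ∀ q ∈ P, (rootsOfValuation ϖ n w (m q)).encard = (((q.2 : ℤ) - q.1).toNat : ℕ) := by
    intro q hq
    obtain ⟨h1, h2⟩ := hPmem q hq
    obtain ⟨h3, h4⟩ := hm q h1 h2
    exact encard_rootsOfValuation hϖ h1 (hchar _ _ h1) h3 h4
  have hminim : ∀ q ∈ P, ∀ q' ∈ P, m q = m q' →
      n q.1 + m q * q.1 ≤ n q'.1 + m q * q'.1 := by
    intro q hq q' hq' hmq
    obtain ⟨h1, h2⟩ := hPmem q hq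
    obtain ⟨h3, h4⟩ := hm q h1 h2
    by_cases e1 : q'.1 = q.1
    · rw [e1]
    by_cases e2 : q'.1 = q.2
    · rw [e2, h3]
    exact (h4 _ e1 e2).le
  -- For a common slope both edges consist of minimizers of `n γ + m * γ`, and the only minimizers
  -- are the two endpoints of `q`.
  have hinj : ∀ q ∈ P, ∀ q' ∈ P, m q = m q' → q = q' := by
    intro q hq q' hq' hmq
    obtain ⟨h1, h2⟩ := hPmem q hq
    obtain ⟨h3, h4⟩ := hm q h1 h2
    obtain ⟨h1', h2'⟩ := hPmem q' hq'
    obtain ⟨h3', h4'⟩ := hm q' h1' h2'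
    have hval := le_antisymm (hminim q hq q' hq' hmq)
      (by rw [hmq]; exact hminim q' hq' q hq hmq.symm)
    rw [← hmq] at h3'
    have hA : q'.1 = q.1 ∨ q'.1 = q.2 := by
      by_contra! h
      exact (h4 _ h.1 h.2).ne hval
    have hB : q'.2 = q.1 ∨ q'.2 = q.2 := by
      by_contra! h
      exact (h4 _ h.1 h.2).ne (hval.trans h3')
    rcases hA with hA | hA <;> rcases hB with hB | hB
    · rw [hA, hB] at h1'
      exact absurd h1' (lt_irrefl _)
    · exact Prod.ext hA.symm hB.symm
    · rw [hA, hB] at h1'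
      exact absurd h1' (lt_asymm h1)
    · rw [hA, hB] at h1'
      exact absurd h1' (lt_irrefl _)
  have hdisj : (P : Set (𝒜 × 𝒜)).PairwiseDisjoint fun q => rootsOfValuation ϖ n w (m q) := by
    intro q hq q' hq' hne
    refine Set.disjoint_left.mpr ?_
    rintro x ⟨_, u, hu⟩ ⟨_, v, hv⟩
    exact hne (hinj q hq q' hq' (zpow_mul_unit_inj hϖ (hu.symm.trans hv)).1)
  have hsum : (edgeLength n : ℕ∞) = (⋃ q ∈ P, rootsOfValuation ϖ n w (m q)).encard := by
    have := P.finite_toSet.encard_biUnion hdisj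
    simp only [Finset.mem_coe] at this
    rw [this, finsum_mem_finset_eq_sum, Finset.sum_congr rfl hcard, edgeLength]
    push_cast
    rfl
  rw [hsum]
  refine Set.encard_le_encard (Set.iUnion₂_subset fun q _ x hx => hx.1)

/-- Without collinear triples, the two minimizers at the valuation of a root are the only ones, so
every root belongs to an integral edge. -/
theorem encard_le_edgeLength [Nonempty 𝒜] (hϖ : Irreducible ϖ) (n : 𝒜 → ℤ) (w : 𝒜 → 𝒪[K]ˣ)
    (hchar : ∀ α β : 𝒜, α < β → ((((β : ℤ) - α).toNat : ℕ) : 𝓀[K]) ≠ 0)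
    (hgen : ∀ q ∈ distinctTriples 𝒜, n ∉ integralCollinearSet q.1 q.2.1 q.2.2) :
    (zeroSet (poly 𝒜 fun γ => (ϖ : K) ^ n γ * ((w γ : 𝒪[K]) : K))).encard ≤ edgeLength n := by
  classical
  choose m hm using exists_slope_of_mem (n := n)
  set P := (increasingPairs 𝒜).filter fun q => n ∈ integralEdgeSet q.1 q.2 with hP
  have hPmem : ∀ q, q ∈ P ↔ q.1 < q.2 ∧ n ∈ integralEdgeSet q.1 q.2 := by
    intro q
    simp [P, increasingPairs, position_lt_iff]
  have hcard : ∀ q ∈ P, (rootsOfValuation ϖ n w (m q)).encard = (((q.2 : ℤ) - q.1).toNat : ℕ) := by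
    intro q hq
    obtain ⟨h1, h2⟩ := (hPmem q).mp hq
    obtain ⟨h3, h4⟩ := hm q h1 h2
    exact encard_rootsOfValuation hϖ h1 (hchar _ _ h1) h3 h4
  have hsub : zeroSet (poly 𝒜 fun γ => (ϖ : K) ^ n γ * ((w γ : 𝒪[K]) : K)) ⊆
      ⋃ q ∈ P, rootsOfValuation ϖ n w (m q) := by
    intro x hx
    obtain ⟨k, u, hu⟩ := exists_eq_zpow_mul hϖ x
    obtain ⟨α, β, hαβ, heq, hle⟩ := exists_two_minimizers hϖ hu hx
    have hlt : ∀ γ : 𝒜, γ ≠ α → γ ≠ β → n α + k * α < n γ + k * γ := by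
      intro γ h1 h2
      refine lt_of_le_of_ne (hle γ) fun h => ?_
      refine hgen (α, β, γ) ?_ (mem_integralCollinearSet heq h)
      simp [distinctTriples, hαβ.ne, h1, h2]
    have hmem : n ∈ integralEdgeSet α β := (mem_integralEdgeSet_iff hαβ).mpr ⟨k, heq, hlt⟩
    have hk : k = m (α, β) := by
      have h1 := (hm (α, β) hαβ hmem).1
      have h2 : (k - m (α, β)) * ((β : ℤ) - α) = 0 := by
        simp only at h1
        linear_combination h1 - heq
      have hαβ' : (α : ℤ) < β := hαβ
      rcases mul_eq_zero.mp h2 with h | h <;> omega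
    simp only [Set.mem_iUnion]
    exact ⟨(α, β), (hPmem _).mpr ⟨hαβ, hmem⟩, hx, u, by rw [← hk]; exact hu⟩
  refine (Set.encard_le_encard hsub).trans ((P.set_encard_biUnion_le _).trans ?_)
  rw [Finset.sum_congr rfl hcard, edgeLength]
  push_cast
  rfl

end EdgeCount

/-! ### Expectations, their limit and the two bounds. -/

section Expectation

variable {K : Type*} [NormedField K] [IsUltrametricDist K] [IsDiscreteValuationRing 𝒪[K]]
  {ϖ : 𝒪[K]}

theorem val_pos (hϖ : Irreducible ϖ) : 0 < val K (ϖ : K) := by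
  have h0 : (ϖ : K) ≠ 0 := fun h => hϖ.ne_zero (Subtype.ext h)
  exact neg_pos.mpr (Real.log_neg (norm_pos_iff.mpr h0) (norm_irreducible_lt_one hϖ))

/-- The law depends on `ϖ` and `M` only through the integer part of `M / v(ϖ)`, so the limit cannot
depend on `ϖ`. -/
theorem valuationLaw_eq (hϖ : Irreducible ϖ) {M : ℝ} (hM : 0 ≤ M) :
    valuationLaw ϖ M = uniformOn
      ((Finset.Icc (-(⌊M / val K (ϖ : K)⌋₊ : ℤ)) ⌊M / val K (ϖ : K)⌋₊ : Finset ℤ) : Set ℤ) := by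
  have hv := val_pos hϖ
  rw [valuationLaw]
  congr 1
  ext n
  have h1 : (n : ℝ) * val K (ϖ : K) ∈ Set.Icc (-M) M ↔
      (|n| : ℝ) ≤ M / val K (ϖ : K) := by
    rw [le_div_iff₀ hv, Set.mem_Icc, ← abs_le, abs_mul, abs_of_pos hv]
  have h2 : (|n| : ℝ) = ((n.natAbs : ℕ) : ℝ) := by
    rw [Nat.cast_natAbs, Int.cast_abs]
  rw [Set.mem_ofPred_eq, h1, h2, ← Nat.le_floor_iff (by positivity), Finset.mem_coe,
    Finset.mem_Icc]
  omega

theorem isProbabilityMeasure_uniform (N : ℕ) :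
    IsProbabilityMeasure (uniformOn ((Finset.Icc (-(N : ℤ)) N : Finset ℤ) : Set ℤ)) :=
  isProbabilityMeasure_uniformOn (Finset.finite_toSet _) ⟨0, by simp⟩

theorem pi_uniform {ι : Type*} [Fintype ι] (N : ℕ) :
    Measure.pi (fun _ : ι => uniformOn ((Finset.Icc (-(N : ℤ)) N : Finset ℤ) : Set ℤ))
      = uniformOn (box ι N : Set (ι → ℤ)) := by
  classical
  have := isProbabilityMeasure_uniform N
  refine Measure.ext_of_singleton fun f => ?_
  have h1 : ∀ x : ℤ, uniformOn ((Finset.Icc (-(N : ℤ)) N : Finset ℤ) : Set ℤ) {x}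
      = if x ∈ Finset.Icc (-(N : ℤ)) N then ((2 * N + 1 : ℕ) : ℝ≥0∞)⁻¹ else 0 := by
    intro x
    have hc : (Finset.Icc (-(N : ℤ)) N).card = 2 * N + 1 := by
      rw [Int.card_Icc]; omega
    rw [← Finset.coe_singleton, uniformOn_apply_finset, hc]
    split_ifs with h
    · rw [Finset.inter_singleton_of_mem h]; simp
    · rw [Finset.inter_singleton_of_notMem h]; simp
  rw [Measure.pi_singleton, ← Finset.coe_singleton, uniformOn_apply_finset, card_box]
  simp only [h1]
  by_cases h : f ∈ box ι N
  · have h' : ∀ i, f i ∈ Finset.Icc (-(N : ℤ)) N := by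
      simpa only [box, Fintype.mem_piFinset] using h
    rw [Finset.inter_singleton_of_mem h]
    simp only [h', if_true, Finset.prod_const, Finset.card_univ, Finset.card_singleton]
    rw [Nat.cast_pow, ENNReal.inv_pow.symm]
    simp
  · have h' : ∃ i, f i ∉ Finset.Icc (-(N : ℤ)) N := by
      by_contra! h'
      exact h (by simpa only [box, Fintype.mem_piFinset] using h')
    obtain ⟨i, hi⟩ := h'
    rw [Finset.inter_singleton_of_notMem h, Finset.prod_eq_zero (Finset.mem_univ i) (if_neg hi)]
    simp

theorem uniformOn_box_apply {ι : Type*} [Fintype ι] (N : ℕ) (A : Set (ι → ℤ)) :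
    uniformOn (box ι N : Set (ι → ℤ)) A = ENNReal.ofReal
      ((Nat.card {m : ι → ℤ | m ∈ box ι N ∧ m ∈ A} : ℝ) / (box ι N).card) := by
  classical
  have h1 : {m : ι → ℤ | m ∈ box ι N ∧ m ∈ A} = ((box ι N).filter (· ∈ A) : Finset _) := by
    ext m; simp
  have h2 : (box ι N : Set (ι → ℤ)) ∩ A = ((box ι N).filter (· ∈ A) : Finset _) := by
    ext m; simp
  have hpos : 0 < (box ι N).card := by rw [card_box]; positivity
  rw [← uniformOn_inter_self (Finset.finite_toSet _), h2, uniformOn_apply_finset, h1,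
    ENNReal.ofReal_div_of_pos (by exact_mod_cast hpos), ENNReal.ofReal_natCast,
    ENNReal.ofReal_natCast, Nat.card_eq_fintype_card, Finset.inter_eq_right.mpr
    (Finset.filter_subset _ _)]
  congr 2
  rw [← Set.toFinset_card, Finset.toFinset_coe]

variable {𝒜 : Finset ℤ}

/-- The expectation of a function of the valuations of the coefficients only. -/
theorem lintegral_coeffLaw (hϖ : Irreducible ϖ) [MeasurableSpace 𝓀[K]ˣ] (D₁ : Measure 𝓀[K]ˣ)
    [IsProbabilityMeasure D₁] [MeasurableSpace (OneUnits K)] (D₂ : Measure (OneUnits K))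
    [IsProbabilityMeasure D₂] {M : ℝ} (hM : 0 ≤ M) (h : (𝒜 → ℤ) → ℝ≥0∞) :
    ∫⁻ c : 𝒜 → CoeffData K, h (fun α => (c α).1) ∂(Measure.pi fun _ => coeffLaw ϖ D₁ D₂ M)
      = ∫⁻ n, h n ∂(uniformOn (box 𝒜 ⌊M / val K (ϖ : K)⌋₊ : Set (𝒜 → ℤ))) := by
  have hprob := isProbabilityMeasure_uniform ⌊M / val K (ϖ : K)⌋₊
  have hfst : (coeffLaw ϖ D₁ D₂ M).map Prod.fst = uniformOn
      ((Finset.Icc (-(⌊M / val K (ϖ : K)⌋₊ : ℤ)) ⌊M / val K (ϖ : K)⌋₊ : Finset ℤ) : Set ℤ) := by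
    rw [coeffLaw, Measure.map_fst_prod, valuationLaw_eq hϖ hM]
    simp
  have : ∀ _ : 𝒜, SigmaFinite ((coeffLaw ϖ D₁ D₂ M).map Prod.fst) := fun _ => by
    rw [hfst]; infer_instance
  have hmap := Measure.pi_map_pi (μ := fun _ : 𝒜 => coeffLaw ϖ D₁ D₂ M)
    (Y := fun _ => ℤ) (f := fun _ => Prod.fst) (hμ := this) (fun _ => measurable_fst.aemeasurable)
  simp only [hfst] at hmap
  rw [pi_uniform] at hmap
  rw [← hmap, lintegral_map (measurable_of_countable h) (by fun_prop)]

/-- Digit and tail merge into a unit, about which nothing more is needed. Hence `Δ`, `D₁` and `D₂`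
do not affect the limit. -/
theorem exists_unit_coeff {Δ : 𝓀[K]ˣ → 𝒪[K]} (hΔ : IsDigitSection K Δ) (c : 𝒜 → CoeffData K) :
    ∃ w : 𝒜 → 𝒪[K]ˣ, (fun α => coeff ϖ Δ (c α))
      = fun α => (ϖ : K) ^ (c α).1 * ((w α : 𝒪[K]) : K) := by
  have h1 : ∀ ε, IsUnit (Δ ε) := fun ε => by
    rw [← IsLocalRing.residue_ne_zero_iff_isUnit, hΔ ε]
    exact ε.ne_zero
  have h2 : ∀ e : OneUnits K, IsUnit (e : 𝒪[K]) := fun e => by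
    rw [← IsLocalRing.residue_ne_zero_iff_isUnit]
    have h3 : IsLocalRing.residue 𝒪[K] ((e : 𝒪[K]) - 1) = 0 :=
      (IsLocalRing.residue_eq_zero_iff _).mpr e.2
    rw [map_sub, map_one, sub_eq_zero] at h3
    rw [h3]
    exact one_ne_zero
  refine ⟨fun α => ((h1 (c α).2.1).mul (h2 (c α).2.2)).unit, ?_⟩
  ext α
  simp [coeff, mul_assoc]

/-- The limit of the expected number of roots. -/
noncomputable def limitExpectation (𝒜 : Finset ℤ) : ℝ :=
  ∑ q ∈ increasingPairs 𝒜,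
    (cubeMeasure 𝒜).real (edgeSet position q.1 q.2) / 2 ^ Fintype.card 𝒜

theorem tendsto_uniformOn_integralEdgeSet {α β : 𝒜} (hαβ : α < β) :
    Tendsto (fun N : ℕ => uniformOn (box 𝒜 N : Set (𝒜 → ℤ)) (integralEdgeSet α β)) atTop
      (𝓝 (ENNReal.ofReal ((cubeMeasure 𝒜).real (edgeSet position α β) / 2 ^ Fintype.card 𝒜
        / (((β : ℤ) - α).toNat : ℕ)))) := by
  have hαβ' : (α : ℤ) < β := hαβ
  simp only [uniformOn_box_apply]
  exact ENNReal.tendsto_ofReal (tendsto_card_cone (measurableSet_edgeSet _ _ _)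
    (convex_edgeSet _ _ _) (fun c hc x => smul_mem_edgeSet_iff _ _ _ hc x) hαβ.ne (by omega))

theorem tendsto_uniformOn_integralCollinearSet {α β γ : 𝒜} (hαβ : α ≠ β) (hα : γ ≠ α)
    (hβ : γ ≠ β) :
    Tendsto (fun N : ℕ => uniformOn (box 𝒜 N : Set (𝒜 → ℤ)) (integralCollinearSet α β γ)) atTop
      (𝓝 0) := by
  -- Modulus `1` makes the congruence vacuous.
  have h1 := tendsto_card_cone (measurableSet_collinearSet (position : 𝒜 → ℝ) α β γ)
    (convex_collinearSet _ _ _ _) (fun c hc x => smul_mem_collinearSet_iff _ _ _ _ hc x) hαβ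
    one_ne_zero
  have h2 : (cubeMeasure 𝒜).real (collinearSet position α β γ) = 0 := by
    rw [measureReal_def, cubeMeasure_eq_zero
      (volume_collinearSet (position_injective.ne hαβ) hα hβ), ENNReal.toReal_zero]
  rw [h2, zero_div, zero_div] at h1
  have h3 := ENNReal.tendsto_ofReal h1
  rw [ENNReal.ofReal_zero] at h3
  simpa [uniformOn_box_apply, integralCollinearSet] using h3

theorem lintegral_edgeLength (μ : Measure (𝒜 → ℤ)) :
    ∫⁻ n, (edgeLength n : ℝ≥0∞) ∂μ =
      ∑ q ∈ increasingPairs 𝒜, (((q.2 : ℤ) - q.1).toNat : ℝ≥0∞) * μ (integralEdgeSet q.1 q.2) := by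
  classical
  have h : ∀ n : 𝒜 → ℤ, (edgeLength n : ℝ≥0∞) = ∑ q ∈ increasingPairs 𝒜,
      (integralEdgeSet q.1 q.2).indicator (fun _ => (((q.2 : ℤ) - q.1).toNat : ℝ≥0∞)) n := by
    intro n
    rw [edgeLength, Finset.sum_filter]
    push_cast
    refine Finset.sum_congr rfl fun q _ => ?_
    simp [Set.indicator_apply]
  simp only [h]
  rw [lintegral_finsetSum _ fun q _ => measurable_of_countable _]
  refine Finset.sum_congr rfl fun q _ => ?_
  rw [lintegral_indicator_const (Set.to_countable _).measurableSet]

theorem tendsto_lintegral_edgeLength (𝒜 : Finset ℤ) :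
    Tendsto (fun N : ℕ => ∫⁻ n, (edgeLength n : ℝ≥0∞) ∂(uniformOn (box 𝒜 N : Set (𝒜 → ℤ))))
      atTop (𝓝 (ENNReal.ofReal (limitExpectation 𝒜))) := by
  simp only [lintegral_edgeLength]
  rw [limitExpectation, ENNReal.ofReal_sum_of_nonneg fun _ _ => by positivity]
  refine tendsto_finsetSum _ fun q hq => ?_
  have hq' : q.1 < q.2 := by simpa [increasingPairs, position_lt_iff] using hq
  have hq'' : (q.1 : ℤ) < q.2 := hq'
  have h1 := ENNReal.Tendsto.const_mul (a := (((q.2 : ℤ) - q.1).toNat : ℝ≥0∞))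
    (tendsto_uniformOn_integralEdgeSet hq') (Or.inr (ENNReal.natCast_ne_top _))
  convert h1 using 2
  have hd : (0 : ℝ) < (((q.2 : ℤ) - q.1).toNat : ℕ) := by
    have : 0 < ((q.2 : ℤ) - q.1).toNat := by omega
    exact_mod_cast this
  -- The length of the edge cancels the density of the congruence.
  rw [← ENNReal.ofReal_natCast, ← ENNReal.ofReal_mul hd.le, mul_div_cancel₀ _ hd.ne']

theorem limitExpectation_eq (𝒜 : Finset ℤ) : limitExpectation 𝒜 =
    (ascendingMass (position : 𝒜 → ℝ) + ascendingMass (-position : 𝒜 → ℝ))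
      / 2 ^ Fintype.card 𝒜 := by
  rw [← sum_edgeSet_eq, limitExpectation, increasingPairs, ← Finset.sum_div]
  congr 1
  simp only [Finset.sum_filter]
  rw [Fintype.sum_prod_type]

theorem limitExpectation_le (𝒜 : Finset ℤ) :
    limitExpectation 𝒜 ≤ 2 * Real.log (𝒜.card : ℝ) := by
  have h1 := ascendingMass_le (position_injective (𝒜 := 𝒜))
  have h2 := ascendingMass_le (p := -position) (neg_injective.comp (position_injective (𝒜 := 𝒜)))
  rw [limitExpectation_eq, div_le_iff₀ (by positivity)]
  rw [Fintype.card_coe] at *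
  linarith

theorem le_limitExpectation [Nonempty 𝒜] : 2 - 2 / (𝒜.card : ℝ) ≤ limitExpectation 𝒜 := by
  have h1 := le_ascendingMass (position_injective (𝒜 := 𝒜))
  have h2 := le_ascendingMass (p := -position) (neg_injective.comp (position_injective (𝒜 := 𝒜)))
  rw [limitExpectation_eq, le_div_iff₀ (by positivity)]
  rw [Fintype.card_coe] at *
  have h3 : (2 : ℝ) / 𝒜.card = 2 * (1 / 𝒜.card) := by ring
  rw [h3]
  linarith

theorem natCast_sub_ne_zero {k : Type*} [Field k]
    (hchar : ringChar k = 0 ∨ ∀ α ∈ 𝒜, ∀ β ∈ 𝒜, |α - β| < (ringChar k : ℤ))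
    (α β : 𝒜) (hαβ : α < β) : ((((β : ℤ) - α).toNat : ℕ) : k) ≠ 0 := by
  have hαβ' : (α : ℤ) < β := hαβ
  rw [Ne, ringChar.spec]
  intro hdvd
  rcases hchar with h | h
  · rw [h, zero_dvd_iff] at hdvd
    omega
  · have h1 := h β β.2 α α.2
    have h2 := Nat.le_of_dvd (by omega) hdvd
    rw [abs_of_pos (by omega)] at h1
    omega

variable [CompleteSpace K] [IsAlgClosed 𝓀[K]]

/-- A pointwise comparison of lower integrals, so the number of roots need not be measurable. -/
theorem lintegral_edgeLength_le_expectedRoots (hϖ : Irreducible ϖ) {Δ : 𝓀[K]ˣ → 𝒪[K]}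
    (hΔ : IsDigitSection K Δ)
    (hchar : ∀ α β : 𝒜, α < β → ((((β : ℤ) - α).toNat : ℕ) : 𝓀[K]) ≠ 0)
    [MeasurableSpace 𝓀[K]ˣ] (D₁ : Measure 𝓀[K]ˣ) [IsProbabilityMeasure D₁]
    [MeasurableSpace (OneUnits K)] (D₂ : Measure (OneUnits K)) [IsProbabilityMeasure D₂]
    {M : ℝ} (hM : 0 ≤ M) :
    ∫⁻ n, (edgeLength n : ℝ≥0∞) ∂(uniformOn (box 𝒜 ⌊M / val K (ϖ : K)⌋₊ : Set (𝒜 → ℤ)))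
      ≤ expectedRoots 𝒜 ϖ Δ D₁ D₂ M := by
  rw [← lintegral_coeffLaw hϖ D₁ D₂ hM, expectedRoots]
  refine lintegral_mono fun c => ?_
  obtain ⟨w, hw⟩ := exists_unit_coeff (ϖ := ϖ) hΔ c
  rw [hw]
  have h := ENat.toENNReal_le.mpr (edgeLength_le_encard hϖ (fun α => (c α).1) w hchar)
  rwa [ENat.toENNReal_coe] at h

/-- The error term charges the degree bound to each collinear triple. -/
theorem expectedRoots_le [Nonempty 𝒜] (hϖ : Irreducible ϖ) {Δ : 𝓀[K]ˣ → 𝒪[K]}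
    (hΔ : IsDigitSection K Δ)
    (hchar : ∀ α β : 𝒜, α < β → ((((β : ℤ) - α).toNat : ℕ) : 𝓀[K]) ≠ 0)
    [MeasurableSpace 𝓀[K]ˣ] (D₁ : Measure 𝓀[K]ˣ) [IsProbabilityMeasure D₁]
    [MeasurableSpace (OneUnits K)] (D₂ : Measure (OneUnits K)) [IsProbabilityMeasure D₂]
    {o : ℤ} (ho : ∀ γ ∈ 𝒜, o ≤ γ) {M : ℝ} (hM : 0 ≤ M) :
    expectedRoots 𝒜 ϖ Δ D₁ D₂ M ≤
      ∫⁻ n, (edgeLength n : ℝ≥0∞) ∂(uniformOn (box 𝒜 ⌊M / val K (ϖ : K)⌋₊ : Set (𝒜 → ℤ))) +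
      ∑ q ∈ distinctTriples 𝒜, ((∑ γ : 𝒜, ((γ : ℤ) - o).toNat : ℕ) : ℝ≥0∞) *
        uniformOn (box 𝒜 ⌊M / val K (ϖ : K)⌋₊ : Set (𝒜 → ℤ))
          (integralCollinearSet q.1 q.2.1 q.2.2) := by
  classical
  set D : ℕ := ∑ γ : 𝒜, ((γ : ℤ) - o).toNat with hD
  set μ := uniformOn (box 𝒜 ⌊M / val K (ϖ : K)⌋₊ : Set (𝒜 → ℤ)) with hμ
  have h1 : ∀ q : 𝒜 × 𝒜 × 𝒜, (D : ℝ≥0∞) * μ (integralCollinearSet q.1 q.2.1 q.2.2) =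
      ∫⁻ n, (integralCollinearSet q.1 q.2.1 q.2.2).indicator (fun _ => (D : ℝ≥0∞)) n ∂μ :=
    fun q => (lintegral_indicator_const (Set.to_countable _).measurableSet _).symm
  simp only [h1]
  rw [← lintegral_finsetSum _ fun q _ => measurable_of_countable _,
    ← lintegral_add_left (measurable_of_countable _), hμ, ← lintegral_coeffLaw hϖ D₁ D₂ hM,
    expectedRoots]
  refine lintegral_mono fun c => ?_
  obtain ⟨w, hw⟩ := exists_unit_coeff (ϖ := ϖ) hΔ c
  rw [hw]
  by_cases hgen : ∀ q ∈ distinctTriples 𝒜,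
      (fun α => (c α).1) ∉ integralCollinearSet q.1 q.2.1 q.2.2
  · refine le_add_right ?_
    have h := ENat.toENNReal_le.mpr (encard_le_edgeLength hϖ (fun α => (c α).1) w hchar hgen)
    rwa [ENat.toENNReal_coe] at h
  · push Not at hgen
    obtain ⟨q, hq, hmem⟩ := hgen
    refine le_add_left ?_
    have h0 : (ϖ : K) ≠ 0 := fun h => hϖ.ne_zero (Subtype.ext h)
    have hle := encard_zeroSet_le ho (a := fun γ => (ϖ : K) ^ (c γ).1 * ((w γ : 𝒪[K]) : K))
      (γ := q.1) (mul_ne_zero (zpow_ne_zero _ h0) (coe_unit_ne_zero _))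
    have hle' : ((zeroSet (poly 𝒜 fun γ => (ϖ : K) ^ (c γ).1 * ((w γ : 𝒪[K]) : K))).encard
        : ℝ≥0∞) ≤ D := by
      have h := ENat.toENNReal_le.mpr hle
      rwa [ENat.toENNReal_coe] at h
    refine hle'.trans (le_trans ?_ (Finset.single_le_sum (fun _ _ => bot_le) hq))
    rw [Set.indicator_of_mem hmem]

end Expectation

end RandomRoots

theorem theorem3 {K : Type*} [NormedField K] [IsUltrametricDist K] [CompleteSpace K]
    [IsDiscreteValuationRing 𝒪[K]] [IsAlgClosed 𝓀[K]]
    (𝒜 : Finset ℤ) (h𝒜 : 2 ≤ 𝒜.card)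
    (hchar : ringChar 𝓀[K] = 0 ∨ ∀ α ∈ 𝒜, ∀ β ∈ 𝒜, |α - β| < (ringChar 𝓀[K] : ℤ)) :
    ∃ E : ℝ,
      (∀ (ϖ : 𝒪[K]) (_ : Irreducible ϖ)
        (Δ : 𝓀[K]ˣ → 𝒪[K]) (_ : RandomRoots.IsDigitSection K Δ)
        (_ : MeasurableSpace 𝓀[K]ˣ) (D₁ : Measure 𝓀[K]ˣ) (_ : IsProbabilityMeasure D₁)
        (_ : MeasurableSpace (RandomRoots.OneUnits K))
        (D₂ : Measure (RandomRoots.OneUnits K)) (_ : IsProbabilityMeasure D₂),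
        Tendsto (fun M : ℝ => RandomRoots.expectedRoots 𝒜 ϖ Δ D₁ D₂ M) atTop
          (𝓝 (ENNReal.ofReal E))) ∧
      2 - 2 / (𝒜.card : ℝ) ≤ E ∧ E ≤ 2 * Real.log (𝒜.card : ℝ) := by
  classical
  have hne : Nonempty 𝒜 := (Finset.card_pos.mp (by omega)).to_subtype
  refine ⟨RandomRoots.limitExpectation 𝒜, ?_, RandomRoots.le_limitExpectation,
    RandomRoots.limitExpectation_le 𝒜⟩
  intro ϖ hϖ Δ hΔ _ D₁ _ _ D₂ _
  have hd := RandomRoots.natCast_sub_ne_zero hchar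
  obtain ⟨o, ho⟩ := RandomRoots.exists_lower_bound 𝒜
  have hN : Tendsto (fun M : ℝ => ⌊M / RandomRoots.val K (ϖ : K)⌋₊) atTop atTop :=
    tendsto_nat_floor_atTop.comp (tendsto_id.atTop_div_const (RandomRoots.val_pos hϖ))
  have hlow := (RandomRoots.tendsto_lintegral_edgeLength 𝒜).comp hN
  have herr : Tendsto (fun N : ℕ => ∑ q ∈ RandomRoots.distinctTriples 𝒜,
      ((∑ γ : 𝒜, ((γ : ℤ) - o).toNat : ℕ) : ℝ≥0∞) * uniformOn (RandomRoots.box 𝒜 N : Set (𝒜 → ℤ))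
        (RandomRoots.integralCollinearSet q.1 q.2.1 q.2.2)) atTop (𝓝 0) := by
    rw [← Finset.sum_const_zero (s := RandomRoots.distinctTriples 𝒜)]
    refine tendsto_finsetSum _ fun q hq => ?_
    have hq' : q.1 ≠ q.2.1 ∧ q.2.2 ≠ q.1 ∧ q.2.2 ≠ q.2.1 := by
      simpa [RandomRoots.distinctTriples] using hq
    have h := ENNReal.Tendsto.const_mul (a := ((∑ γ : 𝒜, ((γ : ℤ) - o).toNat : ℕ) : ℝ≥0∞))
      (RandomRoots.tendsto_uniformOn_integralCollinearSet hq'.1 hq'.2.1 hq'.2.2)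
      (Or.inr (ENNReal.natCast_ne_top _))
    rwa [mul_zero] at h
  have hup := ((RandomRoots.tendsto_lintegral_edgeLength 𝒜).add herr).comp hN
  rw [add_zero] at hup
  -- The expectation is squeezed between the expected edge length and the same plus a vanishing
  -- error.
  refine tendsto_of_tendsto_of_tendsto_of_le_of_le' hlow hup ?_ ?_
  · filter_upwards [eventually_ge_atTop 0] with M hM
    exact RandomRoots.lintegral_edgeLength_le_expectedRoots hϖ hΔ hd D₁ D₂ hM
  · filter_upwards [eventually_ge_atTop 0] with M hM
    exact RandomRoots.expectedRoots_le hϖ hΔ hd D₁ D₂ ho hM
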